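/- Consider linear systems $$Ax=b,\qquad \mathbf 0\le x\le\lambda\mathbf 1 \qquad (*)$$ with $n\ge 1$ variables and $m$ equations, where $A\in\mathbb Z^{m\times n}$ is totally unimodular, $b\in\mathbb Z^m$, and $\lambda\ge 1$ is an integer bounded by a fixed polynomial, $\lambda\le p(n,m)$. Suppose moreover that $(*)$ is either infeasible or strictly feasible, i.e. if $(*)$ has a real solution, then there is $\bar x\in\mathbb R^n$ with $A\bar x=b$ and $\mathbf 0<\bar x<\lambda\mathbf 1$. Then there is a strongly polynomial algorithm (one random access machine program over the rationals, the same for all $m,n,A,b,\lambda$ and $p$) which, for every such system, halts and either returns a solution of $(*)$ or correctly decides that $(*)$ is infeasible. Strongly polynomial means: the number of elementary steps (arithmetic operations, comparisons, memory accesses) is bounded by a polynomial in $n,m$, and the encoding lengths of all numbers that occur are bounded by a polynomial in the encoding length of $(m,n,A,b,\lambda)$; both polynomials may depend on $p$. The running time, counted in elementary steps, is $$O\!\left(m^3+m^2n+n^2m+n^2\bigl(2n\lambda\sqrt{2n+1}\bigr)^{1/\log_2(7/5)}\right),$$ and if $\lambda=1$ it is $O(m^3+m^2n+n^2m+n^{5.1})$;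 the constants in the $O$ depend at most on $p$. -/

import Mathlib

/-! ### Random access machines over the rationals

A machine has registers and arrays whose cells hold rational numbers. One step is one elementary
arithmetic operation, one loading of a constant, one memory access or one comparison. A program is
a fixed finite text; in particular it does not depend on the dimensions of its input. -/

namespace RatRAM

/-- The elementary arithmetic operations. -/
inductive ArithOp where
  | add
  | sub
  | mul
  | div

/-- The value of an arithmetic operation; division by zero is undefined. -/
def ArithOp.eval : ArithOp → ℚ → ℚ → Option ℚ
  | .add, x, y => some (x + y)
  | .sub, x, y => some (x - y)
  | .mul, x, y => some (x * y)
  | .div, x, y => if y = 0 then none else some (x / y)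

/-- Programs. Registers and arrays are named by natural numbers (a program mentions only finitely
many of them). -/
inductive Prog where
  /-- do nothing -/
  | skip
  /-- `const d q`: put the constant `q` into register `d` -/
  | const (d : ℕ) (q : ℚ)
  /-- `arith o d a c`: put `(register a) o (register c)` into register `d` -/
  | arith (o : ArithOp) (d a c : ℕ)
  /-- `load d k a`: put into register `d` the cell of array `k` addressed by register `a` -/
  | load (d k a : ℕ)
  /-- `store k a c`: put register `c` into the cell of array `k` addressed by register `a` -/
  | store (k a c : ℕ)
  /-- sequential composition -/
  | seq (P Q : Prog)
  /-- `ifLt a c P Q`: if register `a` < register `c` then `P` else `Q` -/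
  | ifLt (a c : ℕ) (P Q : Prog)
  /-- `whileLt a c P`: while register `a` < register `c` do `P` -/
  | whileLt (a c : ℕ) (P : Prog)

/-- The memory of the machine. -/
structure Mem where
  /-- contents of the registers -/
  reg : ℕ → ℚ
  /-- contents of the arrays -/
  arr : ℕ → ℕ → ℚ

/-- Write `v` into register `d`. -/
def Mem.setReg (s : Mem) (d : ℕ) (v : ℚ) : Mem :=
  { s with reg := Function.update s.reg d v }

/-- Write `v` into cell `i` of array `k`. -/
def Mem.setArr (s : Mem) (k i : ℕ) (v : ℚ) : Mem :=
  { s with arr := Function.update s.arr k (Function.update (s.arr k) i v) }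

/-- The encoding length of a rational number: sign, numerator and denominator in binary. -/
def bitSize (q : ℚ) : ℕ := 1 + q.num.natAbs.size + q.den.size

/-- `Exec P s t w s'`: the program `P`, started in the memory `s`, halts in the memory `s'` after
exactly `t` steps, and `w` is the largest encoding length of a number written into the memory
during the run. A run that divides by zero, or uses as an address a number that is not a natural
number, does not halt. -/
inductive Exec : Prog → Mem → ℕ → ℕ → Mem → Prop
  | skip (s : Mem) : Exec .skip s 0 0 s
  | const (s : Mem) (d : ℕ) (q : ℚ) : Exec (.const d q) s 1 (bitSize q) (s.setReg d q)
  | arith (s : Mem) (o : ArithOp) (d a c : ℕ) (v : ℚ) (hv : o.eval (s.reg a) (s.reg c) = some v) :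
      Exec (.arith o d a c) s 1 (bitSize v) (s.setReg d v)
  | load (s : Mem) (d k a i : ℕ) (hi : s.reg a = (i : ℚ)) :
      Exec (.load d k a) s 1 (bitSize (s.arr k i)) (s.setReg d (s.arr k i))
  | store (s : Mem) (k a c i : ℕ) (hi : s.reg a = (i : ℚ)) :
      Exec (.store k a c) s 1 (bitSize (s.reg c)) (s.setArr k i (s.reg c))
  | seq {P Q : Prog} {s s₁ s₂ : Mem} {t₁ t₂ w₁ w₂ : ℕ}
      (hP : Exec P s t₁ w₁ s₁) (hQ : Exec Q s₁ t₂ w₂ s₂) :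
      Exec (.seq P Q) s (t₁ + t₂) (max w₁ w₂) s₂
  | ifLt_true {P Q : Prog} {s s' : Mem} {t w a c : ℕ} (h : s.reg a < s.reg c)
      (hP : Exec P s t w s') : Exec (.ifLt a c P Q) s (1 + t) w s'
  | ifLt_false {P Q : Prog} {s s' : Mem} {t w a c : ℕ} (h : ¬ s.reg a < s.reg c)
      (hQ : Exec Q s t w s') : Exec (.ifLt a c P Q) s (1 + t) w s'
  | whileLt_true {P : Prog} {s s₁ s₂ : Mem} {t₁ t₂ w₁ w₂ a c : ℕ} (h : s.reg a < s.reg c)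
      (hP : Exec P s t₁ w₁ s₁) (hL : Exec (.whileLt a c P) s₁ t₂ w₂ s₂) :
      Exec (.whileLt a c P) s (1 + t₁ + t₂) (max w₁ w₂) s₂
  | whileLt_false {P : Prog} {s : Mem} {a c : ℕ} (h : ¬ s.reg a < s.reg c) :
      Exec (.whileLt a c P) s 1 0 s

end RatRAM

/-- The data of a linear system `A x = b`, `0 ≤ x ≤ lam • 1` with `m` equations, `n` variables and
integral entries. -/
structure BoundedSystem where
  /-- number of equations -/
  m : ℕ
  /-- number of variables -/
  n : ℕ
  /-- constraint matrix -/
  A : Matrix (Fin m) (Fin n) ℤ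
  /-- right-hand side -/
  b : Fin m → ℤ
  /-- common upper bound of the variables -/
  lam : ℕ

namespace BoundedSystem

open RatRAM

/-- `x` satisfies `A x = b` and `0 ≤ x ≤ lam • 1`. -/
def IsSolution (S : BoundedSystem) (x : Fin S.n → ℝ) : Prop :=
  (S.A.map (Int.cast : ℤ → ℝ)).mulVec x = (fun i => (S.b i : ℝ)) ∧ ∀ j, 0 ≤ x j ∧ x j ≤ S.lam

/-- `x` satisfies `A x = b` and `0 < x < lam • 1`. -/
def IsStrictSolution (S : BoundedSystem) (x : Fin S.n → ℝ) : Prop :=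
  (S.A.map (Int.cast : ℤ → ℝ)).mulVec x = (fun i => (S.b i : ℝ)) ∧ ∀ j, 0 < x j ∧ x j < S.lam

/-- The encoding length of the system. -/
def size (S : BoundedSystem) : ℕ :=
  bitSize S.m + bitSize S.n + bitSize S.lam + ∑ i, ∑ j, bitSize (S.A i j) + ∑ i, bitSize (S.b i)

/-- The memory that presents the system to a program: `m`, `n`, `lam` in the registers 0, 1, 2;
the matrix in array 0, row by row (entry `(i, j)` in cell `i * n + j`); `b` in array 1; all the
other cells are zero. -/
def input (S : BoundedSystem) : Mem where
  reg := fun r => if r = 0 then S.m else if r = 1 then S.n else if r = 2 then S.lam else 0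
  arr := fun k l =>
    if k = 0 then
      if h : l < S.m * S.n then
        S.A (finProdFinEquiv.symm ⟨l, h⟩).1 (finProdFinEquiv.symm ⟨l, h⟩).2
      else 0
    else if k = 1 then
      if h : l < S.m then S.b ⟨l, h⟩ else 0
    else 0

/-- The final memory `s` holds a correct answer: either register 0 holds 1 and the first `n` cells
of array 2 hold a solution, or register 0 holds 0 and the system has no solution. -/
def CorrectAnswer (S : BoundedSystem) (s : Mem) : Prop :=
  (s.reg 0 = 1 ∧ S.IsSolution (fun j => (s.arr 2 j : ℝ))) ∨
    (s.reg 0 = 0 ∧ ¬ ∃ x, S.IsSolution x)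

end BoundedSystem

/-! The algorithm is Gaussian elimination followed by a relaxation (perceptron-like) method; its
cost O(m²n + n²m + n⁵λ²) lies below both required bounds.

Elimination produces an integral matrix `M` and an integral vector `x₀` such that `A * M = 0` and
every solution of `A x = b` satisfies `x = x₀ + M x`. Total unimodularity survives each pivot
(`Matrix.IsTotallyUnimodular.sub_pivot`), so `M` has entries in {-1, 0, 1}. The system `A x = b` is
consistent exactly if the residual `b - A x₀` vanishes.

If a strict solution exists, total unimodularity gives one with slack 1/(2n): for each coordinate,
round the strict solution to an integral one in which that coordinate is at least 1, and to another
in which it is at most λ - 1, and average these 2n points (`exists_solution_with_slack`). Call such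
a solution `y` deep.

The relaxation keeps X = 2n² x₀ + M Y with Y integral. If coordinate v violates its bound, ± row v
of `M` is added to Y. Scaled by 2n², the deep point has slack n, so the squared distance from Y to
2n² y changes by less than -2n + n = -n (`potential_step`). It is at most 4n⁵λ² at the start, so a
violation that remains after 4n⁴λ² rounds excludes deep points, and hence solutions
(`RelaxInv.no_deep_point`). With the Gram matrix `M * Mᵀ` at hand a round takes O(n) steps.

The run is verified in a program logic `Wp` that tracks step counts and number sizes. The time
bounds follow because 1 / log₂(7/5) ≥ 2 (`pow_five_mul_sq_le`). -/

section Elimination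

/-! ### Gaussian elimination that preserves total unimodularity. -/

open Matrix

/-- For a pivot p = ±1 this is the Schur complement of p. A square submatrix of it is the Schur
complement in the submatrix of `T` bordered by row `r` and column `c`, so its determinant is p times
a minor of `T`. For p = 0 nothing changes, so no case distinction is needed by the program. -/
theorem Matrix.IsTotallyUnimodular.sub_pivot {ρ κ : Type*} {T : Matrix ρ κ ℤ}
    (hT : T.IsTotallyUnimodular) (r : ρ) (c : κ) :
    (Matrix.of fun i j => T i j - T r c * T i c * T r j).IsTotallyUnimodular := by
  obtain ⟨σ, hσ⟩ := hT.apply r c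
  by_cases h0 : T r c = 0
  · have : (Matrix.of fun i j => T i j - T r c * T i c * T r j) = T := by
      ext i j
      simp [h0]
    rwa [this]
  have hpp : T r c * T r c = 1 := by
    rw [← hσ] at h0 ⊢
    revert h0
    cases σ <;> simp
  have hdet := (isTotallyUnimodular_iff_fintype T).1 hT
  rw [isTotallyUnimodular_iff]
  intro k f g
  obtain ⟨τ, hτ⟩ := hdet (Unit ⊕ Fin k) (Sum.elim (fun _ => r) f) (Sum.elim (fun _ => c) g)
  set P : Matrix Unit Unit ℤ := Matrix.of fun _ _ => T r c with hP
  have hPP : P * P = 1 := by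
    ext i j
    simp [hP, Matrix.mul_apply, hpp]
  let : Invertible P := ⟨P, hPP, hPP⟩
  have hb : T.submatrix (Sum.elim (fun _ : Unit => r) f) (Sum.elim (fun _ : Unit => c) g) =
      fromBlocks P (Matrix.of fun _ j => T r (g j)) (Matrix.of fun i _ => T (f i) c)
        (T.submatrix f g) := by
    ext i j
    rcases i with i | i <;> rcases j with j | j <;> simp [hP]
  have hS : (Matrix.of fun i j => T i j - T r c * T i c * T r j).submatrix f g =
      T.submatrix f g - (Matrix.of fun i (_ : Unit) => T (f i) c) * ⅟P *
        (Matrix.of fun (_ : Unit) j => T r (g j)) := by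
    have hinv : ⅟P = P := rfl
    rw [hinv]
    ext i j
    simp only [hP, Matrix.submatrix_apply, Matrix.sub_apply, Matrix.mul_apply, Matrix.of_apply,
      Finset.univ_unique, Finset.sum_singleton]
    ring
  rw [hb, det_fromBlocks₁₁, ← hS] at hτ
  have hPd : P.det = T r c := by simp [hP]
  rw [hPd] at hτ
  refine ⟨σ * τ, ?_⟩
  rw [SignType.coe_mul, hτ, ← mul_assoc, hσ, hpp, one_mul]

variable {μ ι : Type*} [Fintype ι]

/-- State of an elimination on `A x = b` after the rows in `S` have been treated: the columns of `M`
span the directions of the solution space of these rows, and `x₀` is a candidate solution. -/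
structure ElimInv (A : Matrix μ ι ℤ) (b : μ → ℤ) (S : Set μ) (M : Matrix ι ι ℤ) (x₀ : ι → ℤ) :
    Prop where
  tu : (fromRows (A * M) M).IsTotallyUnimodular
  zero : ∀ i ∈ S, ∀ j, (A * M) i j = 0
  sol : ∀ x : ι → ℝ, (A.map (Int.cast : ℤ → ℝ)).mulVec x = (fun i => (b i : ℝ)) →
    ∀ k, x k = x₀ k + ∑ j, (M k j : ℝ) * x j

theorem ElimInv.init [DecidableEq ι] {A : Matrix μ ι ℤ} (hA : A.IsTotallyUnimodular)
    (b : μ → ℤ) : ElimInv A b ∅ 1 0 where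
  tu := by
    rw [Matrix.mul_one]
    exact (fromRows_one_isTotallyUnimodular_iff A).2 hA
  zero := by simp
  sol := by
    intro x _ k
    simp [Matrix.one_apply]

/-- The rank one update that eliminates row `r` by means of column `c`. -/
def pivotMat (A : Matrix μ ι ℤ) (M : Matrix ι ι ℤ) (r : μ) (c : ι) : Matrix ι ι ℤ :=
  Matrix.of fun k j => M k j - (A * M) r c * M k c * (A * M) r j

/-- The candidate solution after the elimination of row `r` by means of column `c`. -/
def pivotVec (A : Matrix μ ι ℤ) (b : μ → ℤ) (M : Matrix ι ι ℤ) (x₀ : ι → ℤ) (r : μ) (c : ι) :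
    ι → ℤ :=
  fun k => x₀ k + (A * M) r c * M k c * (b r - A.mulVec x₀ r)

theorem mul_pivotMat (A : Matrix μ ι ℤ) (M : Matrix ι ι ℤ) (r : μ) (c : ι) (i : μ) (j : ι) :
    (A * pivotMat A M r c) i j = (A * M) i j - (A * M) r c * (A * M) i c * (A * M) r j := by
  have h : ∀ j, (A * M) i j = ∑ k, A i k * M k j := fun j => Matrix.mul_apply
  rw [Matrix.mul_apply, h j, h c]
  simp only [pivotMat, Matrix.of_apply, mul_sub, Finset.sum_sub_distrib, Finset.mul_sum,
    Finset.sum_mul]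
  congr 1
  refine Finset.sum_congr rfl fun k _ => by ring

theorem mulVec_pivotVec (A : Matrix μ ι ℤ) (b : μ → ℤ) (M : Matrix ι ι ℤ) (x₀ : ι → ℤ) (r : μ)
    (c : ι) (i : μ) :
    A.mulVec (pivotVec A b M x₀ r c) i =
      A.mulVec x₀ i + (A * M) r c * (A * M) i c * (b r - A.mulVec x₀ r) := by
  have h : (A * M) i c = ∑ k, A i k * M k c := Matrix.mul_apply
  rw [h]
  generalize hq : b r - A.mulVec x₀ r = q
  simp only [pivotVec, Matrix.mulVec, dotProduct, mul_add, Finset.sum_add_distrib, Finset.mul_sum,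
    Finset.sum_mul] at hq ⊢
  rw [hq]
  congr 1
  refine Finset.sum_congr rfl fun k _ => by ring

/-- The stacked matrix undergoes one common pivot, which gives `tu`. A solution x has residual `b r
- (A x₀) r` equal to row r of `A * M` applied to x, so what is added to `x₀` is exactly what is
removed from `M x`. The hypothesis `hc` admits a zero pivot only when the row is already zero; the
update is then trivial. -/
theorem ElimInv.pivot {A : Matrix μ ι ℤ} {b : μ → ℤ} {S : Set μ} {M : Matrix ι ι ℤ} {x₀ : ι → ℤ}
    (h : ElimInv A b S M x₀) (r : μ) (c : ι) (hc : (A * M) r c = 0 → ∀ j, (A * M) r j = 0) :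
    ElimInv A b (insert r S) (pivotMat A M r c) (pivotVec A b M x₀ r c) where
  tu := by
    convert h.tu.sub_pivot (Sum.inl r) c using 1
    ext i j
    rcases i with i | i
    · simp [mul_pivotMat]
    · simp [pivotMat]
  zero := by
    intro i hi j
    rw [mul_pivotMat]
    rcases hi with rfl | hi
    · by_cases h0 : (A * M) i c = 0
      · simp [h0, hc h0]
      -- The pivot is ±1, its square is 1, and the row cancels itself.
      · obtain ⟨σ, hσ⟩ := h.tu.apply (Sum.inl i) c
        rw [fromRows_apply_inl] at hσ
        rw [← hσ] at h0 ⊢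
        cases σ <;> simp at h0 ⊢
    · simp [h.zero i hi]
  sol := by
    intro x hx k
    have hk := h.sol x hx
    have hr : (b r : ℝ) - (A.mulVec x₀ r : ℤ) = ∑ j, ((A * M) r j : ℝ) * x j := by
      have h1 := congrFun hx r
      have h2 : (b r : ℝ) = ∑ k, (A r k : ℝ) * (x₀ k + ∑ j, (M k j : ℝ) * x j) := by
        rw [← h1]
        simp only [Matrix.mulVec, dotProduct, Matrix.map_apply]
        exact Finset.sum_congr rfl fun k _ => by rw [← hk k]
      rw [h2]
      simp only [Matrix.mulVec, dotProduct, Matrix.mul_apply, mul_add, Finset.sum_add_distrib]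
      push_cast
      rw [add_sub_cancel_left]
      simp only [Finset.mul_sum, Finset.sum_mul]
      rw [Finset.sum_comm]
      exact Finset.sum_congr rfl fun _ _ => Finset.sum_congr rfl fun _ _ => by ring
    simp only [pivotVec, pivotMat, Matrix.of_apply]
    push_cast
    rw [hr]
    simp only [sub_mul, Finset.sum_sub_distrib]
    have : ∑ j, ((A * M) r c : ℝ) * M k c * (A * M) r j * x j =
        (A * M) r c * M k c * ∑ j, ((A * M) r j : ℝ) * x j := by
      rw [Finset.mul_sum]
      exact Finset.sum_congr rfl fun _ _ => by ring
    rw [this]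
    linarith [hk k]

/-- Existence alone suffices for the rounding argument, which eliminates on a submatrix; the program
carries out its own pivots explicitly. -/
theorem exists_elimInv [DecidableEq ι] {A : Matrix μ ι ℤ} (hA : A.IsTotallyUnimodular)
    (b : μ → ℤ) (S : Finset μ) : ∃ M x₀, ElimInv A b (S : Set μ) M x₀ := by
  classical
  induction S using Finset.induction_on with
  | empty => exact ⟨1, 0, by simpa using ElimInv.init hA b⟩
  | insert r S _ ih =>
    obtain ⟨M, x₀, h⟩ := ih
    rw [Finset.coe_insert]
    by_cases hr : ∃ c, (A * M) r c ≠ 0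
    · obtain ⟨c, hc⟩ := hr
      exact ⟨_, _, h.pivot r c fun h0 => absurd h0 hc⟩
    · push Not at hr
      refine ⟨M, x₀, h.tu, ?_, h.sol⟩
      rintro i (rfl | hi) j
      · exact hr j
      · exact h.zero i hi j

end Elimination

/-! ### Integral rounding and strict solutions with quantitative slack. -/

section Rounding

open Matrix

variable {μ ι : Type*} [Fintype μ] [Fintype ι]

/-- The columns of the fractional coordinates of a solution of a totally unimodular system with
integral right-hand side are dependent. -/
theorem exists_kernel_vector {A : Matrix μ ι ℤ} (hA : A.IsTotallyUnimodular) (b : μ → ℤ)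
    (x : ι → ℝ) (hx : (A.map (Int.cast : ℤ → ℝ)).mulVec x = (fun i => (b i : ℝ)))
    (hF : {j | ∀ z : ℤ, x j ≠ z}.Nonempty) :
    ∃ d : ι → ℝ, d ≠ 0 ∧ (∀ j ∉ {j | ∀ z : ℤ, x j ≠ z}, d j = 0) ∧
      (A.map (Int.cast : ℤ → ℝ)).mulVec d = 0 := by
  classical
  set F : Set ι := {j | ∀ z : ℤ, x j ≠ z} with hFdef
  have hfloor : ∀ j ∉ F, x j = ⌊x j⌋ := by
    intro j hj
    simp only [hFdef, Set.mem_ofPred_eq, not_forall, not_not] at hj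
    obtain ⟨z, hz⟩ := hj
    simp [hz]
  have hsplit : ∀ f : ι → ℝ, ∑ j, f j = ∑ j : F, f j + ∑ j : {j // j ∉ F}, f j := fun f =>
    (Fintype.sum_subtype_add_sum_subtype (fun j => j ∈ F) f).symm
  -- Only the fractional columns are eliminated; the integral coordinates are moved to the
  -- right-hand side, which stays integral.
  obtain ⟨M, x₀, h⟩ := exists_elimInv (hA.submatrix id (Subtype.val : F → ι))
    (fun i => b i - ∑ j : {j // j ∉ F}, A i j * ⌊x j⌋) Finset.univ
  have hsol := h.sol (fun j => x j) (by
    funext i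
    have hi := congrFun hx i
    simp only [Matrix.mulVec, dotProduct, Matrix.map_apply, Matrix.submatrix_apply, id] at hi ⊢
    rw [hsplit] at hi
    push_cast
    rw [← hi, eq_sub_iff_add_eq]
    congr 1
    exact Finset.sum_congr rfl fun j _ => by rw [← hfloor j j.2])
  obtain ⟨k, hk⟩ := hF
  -- If row k of `M` were zero, then `x k = x₀ k` would be an integer. A column of `M` with a
  -- non-zero entry in row k, extended by zeros, is the kernel vector.
  have hM : ∃ j, M ⟨k, hk⟩ j ≠ 0 := by
    by_contra! h0
    have := hsol ⟨k, hk⟩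
    simp only [h0, Int.cast_zero, zero_mul, Finset.sum_const_zero, add_zero] at this
    exact hk _ this
  obtain ⟨j, hj⟩ := hM
  refine ⟨fun l => if hl : l ∈ F then (M ⟨l, hl⟩ j : ℝ) else 0, ?_, fun l hl => by simp [hl], ?_⟩
  · intro h0
    have := congrFun h0 k
    simp only [hk, dite_true, Pi.zero_apply, Int.cast_eq_zero] at this
    exact hj this
  · funext i
    have hz := h.zero i (by simp) j
    simp only [Matrix.mul_apply, Matrix.submatrix_apply, id] at hz
    simp only [Matrix.mulVec, dotProduct, Matrix.map_apply, Pi.zero_apply]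
    rw [hsplit, Finset.sum_eq_zero (s := (Finset.univ : Finset {j // j ∉ F}))
      (fun l _ => by simp [l.2]), add_zero]
    have : ∀ l : F, (A i l : ℝ) * (if hl : (l : ι) ∈ F then (M ⟨l, hl⟩ j : ℝ) else 0) =
        ((A i l * M l j : ℤ) : ℝ) := fun l => by simp
    rw [Finset.sum_congr rfl fun l _ => this l]
    exact_mod_cast hz

/-- A solution of a totally unimodular system with integral right-hand side can be rounded to an
integral one, in such a way that no coordinate crosses an integer and a prescribed coordinate does
not decrease (`s = 1`) or does not increase (`s = -1`). -/
theorem exists_integral_solution [DecidableEq ι] {A : Matrix μ ι ℤ} (hA : A.IsTotallyUnimodular)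
    (b : μ → ℤ) (s : ℝ) (i₀ : ι) (N : ℕ) : ∀ x : ι → ℝ,
    (A.map (Int.cast : ℤ → ℝ)).mulVec x = (fun i => (b i : ℝ)) →
    {j | ∀ z : ℤ, x j ≠ z}.ncard ≤ N →
    ∃ z : ι → ℤ, (A.map (Int.cast : ℤ → ℝ)).mulVec (fun j => (z j : ℝ)) = (fun i => (b i : ℝ)) ∧
      (∀ j, ⌊x j⌋ ≤ z j ∧ z j ≤ ⌈x j⌉) ∧ s * x i₀ ≤ s * z i₀ := by
  have integral_case : ∀ x : ι → ℝ,
      (A.map (Int.cast : ℤ → ℝ)).mulVec x = (fun i => (b i : ℝ)) →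
      {j | ∀ z : ℤ, x j ≠ z} = ∅ →
      ∃ z : ι → ℤ, (A.map (Int.cast : ℤ → ℝ)).mulVec (fun j => (z j : ℝ)) = (fun i => (b i : ℝ)) ∧
        (∀ j, ⌊x j⌋ ≤ z j ∧ z j ≤ ⌈x j⌉) ∧ s * x i₀ ≤ s * z i₀ := by
    intro x hx hF
    have : ∀ j, ∃ z : ℤ, x j = z := by
      intro j
      by_contra! h
      exact Set.notMem_empty j (hF ▸ h)
    choose z hz using this
    have hxz : x = fun j => (z j : ℝ) := funext hz
    refine ⟨z, hxz ▸ hx, fun j => ?_, by rw [hz]⟩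
    simp [hz]
  induction N with
  | zero =>
    intro x hx hN
    refine integral_case x hx ?_
    rwa [Nat.le_zero, Set.ncard_eq_zero] at hN
  | succ N ih =>
    intro x hx hN
    by_cases hF : {j | ∀ z : ℤ, x j ≠ z} = ∅
    · exact integral_case x hx hF
    set F : Set ι := {j | ∀ z : ℤ, x j ≠ z} with hFdef
    obtain ⟨d, hd0, hdF, hAd⟩ := exists_kernel_vector hA b x hx (Set.nonempty_iff_ne_empty.2 hF)
    -- Replacing d by -d if necessary, moving along d does not decrease `s * x i₀`.
    obtain ⟨d, hd0, hdF, hAd, hds⟩ : ∃ d : ι → ℝ, d ≠ 0 ∧ (∀ j ∉ F, d j = 0) ∧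
        (A.map (Int.cast : ℤ → ℝ)).mulVec d = 0 ∧ 0 ≤ s * d i₀ := by
      rcases le_total 0 (s * d i₀) with h | h
      · exact ⟨d, hd0, hdF, hAd, h⟩
      · exact ⟨-d, neg_ne_zero.2 hd0, fun j hj => by simp [hdF j hj], by
          rw [Matrix.mulVec_neg, hAd, neg_zero], by simpa using h⟩
    have hfl : ∀ j ∈ F, (⌊x j⌋ : ℝ) < x j := fun j hj =>
      lt_of_le_of_ne (Int.floor_le _) fun h => hj _ h.symm
    have hce : ∀ j ∈ F, x j < (⌈x j⌉ : ℝ) := fun j hj =>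
      lt_of_le_of_ne (Int.le_ceil _) fun h => hj _ h
    -- `e j` is the first integer that coordinate j meets when moving along d, and `τ j` the time at
    -- which it meets it. Stopping at the smallest `τ` makes one more coordinate integral without
    -- any coordinate crossing an integer.
    let e : ι → ℤ := fun j => if 0 < d j then ⌈x j⌉ else ⌊x j⌋
    let τ : ι → ℝ := fun j => (e j - x j) / d j
    have hdF' : ∀ j, d j ≠ 0 → j ∈ F := fun j hj => by
      by_contra h
      exact hj (hdF j h)
    obtain ⟨j₁, hj₁⟩ := Function.ne_iff.1 hd0
    obtain ⟨j₀, hj₀, hmin⟩ := Finset.exists_min_image (Finset.univ.filter fun j => d j ≠ 0) τ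
      ⟨j₁, by simpa using hj₁⟩
    simp only [Finset.mem_filter, Finset.mem_univ, true_and] at hj₀ hmin
    have hτpos : 0 < τ j₀ := by
      have hjF := hdF' _ hj₀
      simp only [τ, e]
      split_ifs with h
      · exact div_pos (by linarith [hce _ hjF]) h
      · exact div_pos_of_neg_of_neg (by linarith [hfl _ hjF]) (lt_of_le_of_ne (not_lt.1 h) hj₀)
    set x' : ι → ℝ := x + τ j₀ • d with hx'
    have hx'j : ∀ j, x' j = x j + τ j₀ * d j := fun j => by simp [hx']
    have hAx' : (A.map (Int.cast : ℤ → ℝ)).mulVec x' = (fun i => (b i : ℝ)) := by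
      rw [hx', Matrix.mulVec_add, Matrix.mulVec_smul, hAd, hx]
      simp
    have hbd : ∀ j, (⌊x j⌋ : ℝ) ≤ x' j ∧ x' j ≤ (⌈x j⌉ : ℝ) := by
      intro j
      rw [hx'j]
      have h1 := Int.floor_le (x j)
      have h2 := Int.le_ceil (x j)
      rcases lt_trichotomy (d j) 0 with h | h | h
      · have h3 := hmin j h.ne
        have h4 : τ j * d j = ⌊x j⌋ - x j := by
          simp only [τ, e, if_neg h.not_gt]
          exact div_mul_cancel₀ _ h.ne
        have h5 : τ j * d j ≤ τ j₀ * d j := mul_le_mul_of_nonpos_right h3 h.le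
        have h6 : τ j₀ * d j ≤ 0 := mul_nonpos_of_nonneg_of_nonpos hτpos.le h.le
        constructor <;> linarith
      · simp only [h, mul_zero, add_zero]
        exact ⟨h1, h2⟩
      · have h3 := hmin j h.ne'
        have h4 : τ j * d j = ⌈x j⌉ - x j := by
          simp only [τ, e, if_pos h]
          exact div_mul_cancel₀ _ h.ne'
        have h5 : τ j₀ * d j ≤ τ j * d j := mul_le_mul_of_nonneg_right h3 h.le
        have h6 : 0 ≤ τ j₀ * d j := mul_nonneg hτpos.le h.le
        constructor <;> linarith
    have hsub : {j | ∀ z : ℤ, x' j ≠ z} ⊂ F := by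
      refine (Set.ssubset_iff_of_subset fun j hj => ?_).2 ⟨j₀, hdF' _ hj₀, ?_⟩
      · by_contra h
        have hj' : ∀ z : ℤ, x' j ≠ z := hj
        rw [hx'j, hdF j h] at hj'
        simp only [mul_zero, add_zero] at hj'
        exact h hj'
      · intro h
        refine h (e j₀) ?_
        rw [hx'j]
        simp only [τ]
        field_simp
        ring
    obtain ⟨z, hz, hzb, hzs⟩ := ih x' hAx' (by
      have := Set.ncard_lt_ncard hsub (Set.toFinite _)
      omega)
    refine ⟨z, hz, fun j => ⟨(Int.le_floor.2 (hbd j).1).trans (hzb j).1,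
      (hzb j).2.trans (Int.ceil_le.2 (hbd j).2)⟩, ?_⟩
    rw [hx'j] at hzs
    have : 0 ≤ τ j₀ * (s * d i₀) := mul_nonneg hτpos.le hds
    nlinarith

/-- A strict solution of a totally unimodular system with bounds can be replaced by one with
slack `1 / (2 n)`. -/
theorem exists_solution_with_slack [DecidableEq ι] {A : Matrix μ ι ℤ} (hA : A.IsTotallyUnimodular)
    (b : μ → ℤ) (lam : ℕ) (x : ι → ℝ)
    (hx : (A.map (Int.cast : ℤ → ℝ)).mulVec x = (fun i => (b i : ℝ)))
    (hb : ∀ j, 0 < x j ∧ x j < lam) :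
    ∃ y : ι → ℝ, (A.map (Int.cast : ℤ → ℝ)).mulVec y = (fun i => (b i : ℝ)) ∧
      ∀ j, 1 ≤ 2 * Fintype.card ι * y j ∧ 2 * Fintype.card ι * y j ≤ 2 * Fintype.card ι * lam - 1 := by
  have key : ∀ s : ℝ, ∀ i : ι, ∃ z : ι → ℤ,
      (A.map (Int.cast : ℤ → ℝ)).mulVec (fun j => (z j : ℝ)) = (fun i => (b i : ℝ)) ∧
      (∀ j, (0:ℤ) ≤ z j ∧ z j ≤ lam) ∧ s * x i ≤ s * z i := by
    intro s i
    obtain ⟨z, hz, hzb, hzs⟩ := exists_integral_solution hA b s i _ x hx le_rfl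
    refine ⟨z, hz, fun j => ⟨le_trans (Int.floor_nonneg.2 (hb j).1.le) (hzb j).1,
      (hzb j).2.trans (Int.ceil_le.2 (by exact_mod_cast (hb j).2.le))⟩, hzs⟩
  rcases isEmpty_or_nonempty ι with hι | hι
  · exact ⟨x, hx, fun j => (hι.false j).elim⟩
  choose u hu hub hus using key 1
  choose v hv hvb hvs using key (-1)
  have hn : (0 : ℝ) < Fintype.card ι := by exact_mod_cast Fintype.card_pos
  -- The sum of the 2n integral solutions. In coordinate j all terms lie in [0, λ], with `u j j ≥ 1`
  -- and `v j j ≤ λ - 1`, so the sum keeps distance 1 from 0 and from 2nλ.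
  let w : ι → ℝ := fun j => ∑ i, ((u i j : ℝ) + v i j)
  have hwb : ∀ j, 1 ≤ w j ∧ w j ≤ 2 * Fintype.card ι * lam - 1 := by
    intro j
    have h1 : (1 : ℝ) ≤ u j j := by
      have h := hus j
      have : (0 : ℝ) < u j j := by linarith [(hb j).1]
      exact_mod_cast (show (0 : ℤ) < u j j by exact_mod_cast this)
    have h2 : (v j j : ℝ) + 1 ≤ lam := by
      have h := hvs j
      have : (v j j : ℝ) < lam := by linarith [(hb j).2]
      exact_mod_cast (show v j j < (lam : ℤ) by exact_mod_cast this)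
    have hu0 : ∀ i, (0 : ℝ) ≤ u i j ∧ (u i j : ℝ) ≤ lam := fun i =>
      ⟨by exact_mod_cast (hub i j).1, by exact_mod_cast (hub i j).2⟩
    have hv0 : ∀ i, (0 : ℝ) ≤ v i j ∧ (v i j : ℝ) ≤ lam := fun i =>
      ⟨by exact_mod_cast (hvb i j).1, by exact_mod_cast (hvb i j).2⟩
    constructor
    · calc (1 : ℝ) ≤ u j j + v j j := by linarith [(hv0 j).1]
        _ ≤ w j := Finset.single_le_sum (f := fun i => (u i j : ℝ) + v i j)
          (fun i _ => add_nonneg (hu0 i).1 (hv0 i).1) (Finset.mem_univ j)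
    · have : (1 : ℝ) ≤ ∑ i, (2 * lam - ((u i j : ℝ) + v i j)) :=
        le_trans (by linarith [(hu0 j).2]) (Finset.single_le_sum
          (f := fun i => 2 * (lam : ℝ) - ((u i j : ℝ) + v i j))
          (fun i _ => by linarith [(hu0 i).2, (hv0 i).2]) (Finset.mem_univ j))
      rw [Finset.sum_sub_distrib] at this
      simp only [Finset.sum_const, Finset.card_univ, nsmul_eq_mul] at this
      simp only [w]
      linarith
  refine ⟨fun j => w j / (2 * Fintype.card ι), ?_, fun j => ?_⟩
  · funext i
    have hui : ∀ k, ∑ j, (A i j : ℝ) * u k j = b i := fun k => congrFun (hu k) i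
    have hvi : ∀ k, ∑ j, (A i j : ℝ) * v k j = b i := fun k => congrFun (hv k) i
    simp only [Matrix.mulVec, dotProduct, Matrix.map_apply, w, ← mul_div_assoc]
    rw [← Finset.sum_div, div_eq_iff (by positivity)]
    simp only [Finset.mul_sum]
    rw [Finset.sum_comm]
    simp only [mul_add, Finset.sum_add_distrib, hui, hvi]
    simp
    ring
  · have : 2 * (Fintype.card ι : ℝ) * (w j / (2 * Fintype.card ι)) = w j := by field_simp
    simp only [this]
    exact hwb j

end Rounding

/-! ### The relaxation method and its potential function. -/

section Relaxation

open Matrix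

variable {ι : Type*} [Fintype ι]

/-- `y` is a point of the affine space `x₀ + range M`, parametrized by itself, whose coordinates
keep a distance of at least `1 / (2 n)` from the bounds `0` and `lam`. -/
def IsDeepPoint (M : Matrix ι ι ℤ) (x₀ : ι → ℤ) (lam : ℕ) (y : ι → ℝ) : Prop :=
  (∀ k, y k = x₀ k + ∑ j, (M k j : ℝ) * y j) ∧
    ∀ j, 1 ≤ 2 * Fintype.card ι * y j ∧ 2 * Fintype.card ι * y j ≤ 2 * Fintype.card ι * lam - 1

/-- The state of the relaxation method after `t` steps: the point `X` (scaled by `2 n ^ 2`) satisfies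
the bounds, or the distance of its parameter from every deep point has decreased enough. -/
def RelaxInv (M : Matrix ι ι ℤ) (x₀ : ι → ℤ) (lam t : ℕ) (X : ι → ℤ) : Prop :=
  ∃ Y : ι → ℤ, (∀ k, X k = 2 * (Fintype.card ι : ℤ) ^ 2 * x₀ k + ∑ j, M k j * Y j) ∧
    ((∀ k, 0 ≤ X k ∧ X k ≤ 2 * (Fintype.card ι : ℤ) ^ 2 * lam) ∨
      ∀ y, IsDeepPoint M x₀ lam y →
        ∑ j, ((Y j : ℝ) - 2 * (Fintype.card ι : ℝ) ^ 2 * y j) ^ 2 ≤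
          4 * (Fintype.card ι : ℝ) ^ 5 * lam ^ 2 - t * Fintype.card ι)

theorem RelaxInv.init (M : Matrix ι ι ℤ) (x₀ : ι → ℤ) (lam : ℕ) :
    RelaxInv M x₀ lam 0 fun k => 2 * (Fintype.card ι : ℤ) ^ 2 * x₀ k := by
  refine ⟨0, by simp, Or.inr fun y hy => ?_⟩
  have : ∀ j ∈ (Finset.univ : Finset ι),
      (((0 : ι → ℤ) j : ℝ) - 2 * (Fintype.card ι : ℝ) ^ 2 * y j) ^ 2 ≤
        4 * (Fintype.card ι : ℝ) ^ 4 * lam ^ 2 := by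
    intro j _
    obtain ⟨h1, h2⟩ := hy.2 j
    have hn : (0 : ℝ) < Fintype.card ι := by
      exact_mod_cast Fintype.card_pos_iff.2 ⟨j⟩
    have hy0 : 0 ≤ y j := by
      by_contra! h
      nlinarith
    have hyl : y j ≤ lam := by
      by_contra! h
      nlinarith
    have hsq : y j ^ 2 ≤ (lam : ℝ) ^ 2 := pow_le_pow_left₀ hy0 hyl 2
    have h4 : (0 : ℝ) ≤ 4 * (Fintype.card ι : ℝ) ^ 4 := by positivity
    calc (((0 : ι → ℤ) j : ℝ) - 2 * (Fintype.card ι : ℝ) ^ 2 * y j) ^ 2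
        = 4 * (Fintype.card ι : ℝ) ^ 4 * y j ^ 2 := by simp; ring
      _ ≤ _ := mul_le_mul_of_nonneg_left hsq h4
  refine (Finset.sum_le_card_nsmul _ _ _ this).trans (le_of_eq ?_)
  simp only [Finset.card_univ, nsmul_eq_mul]
  push_cast
  ring

/-- Expanding the square, the cross term is 2σ(X v - 2n² y v), because X and the scaled deep point
have the same affine part 2n² x₀. The violation of the bound together with the slack n of the scaled
point makes it less than -2n, while the squared norm of row v is at most n. -/
theorem potential_step {M : Matrix ι ι ℤ} (hM : ∀ i j, |M i j| ≤ 1) {x₀ : ι → ℤ} {lam : ℕ}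
    {X Y : ι → ℤ} (hX : ∀ k, X k = 2 * (Fintype.card ι : ℤ) ^ 2 * x₀ k + ∑ j, M k j * Y j)
    {v : ι} {σ : ℤ}
    (hσ : (σ = 1 ∧ X v < 0) ∨ (σ = -1 ∧ 2 * (Fintype.card ι : ℤ) ^ 2 * lam < X v))
    {y : ι → ℝ} (hy : IsDeepPoint M x₀ lam y) :
    ∑ j, (((Y j + σ * M v j : ℤ) : ℝ) - 2 * (Fintype.card ι : ℝ) ^ 2 * y j) ^ 2 ≤
      ∑ j, ((Y j : ℝ) - 2 * (Fintype.card ι : ℝ) ^ 2 * y j) ^ 2 - (Fintype.card ι : ℝ) := by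
  set n : ℝ := ((Fintype.card ι : ℕ) : ℝ) with hn
  have hn0 : 0 < n := by
    rw [hn]
    exact_mod_cast Fintype.card_pos_iff.2 ⟨v⟩
  have hσσ : (σ : ℝ) ^ 2 = 1 := by
    rcases hσ with ⟨h, _⟩ | ⟨h, _⟩ <;> simp [h]
  have hexp : ∀ j, (((Y j + σ * M v j : ℤ) : ℝ) - 2 * n ^ 2 * y j) ^ 2 =
      ((Y j : ℝ) - 2 * n ^ 2 * y j) ^ 2 +
        2 * σ * (M v j * Y j - 2 * n ^ 2 * (M v j * y j)) + (M v j : ℝ) ^ 2 := by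
    intro j
    push_cast
    linear_combination (M v j : ℝ) ^ 2 * hσσ
  simp only [hexp, Finset.sum_add_distrib, ← Finset.mul_sum, Finset.sum_sub_distrib]
  have hMv : ∑ j, (M v j : ℝ) ^ 2 ≤ n := by
    have : ∀ j ∈ (Finset.univ : Finset ι), (M v j : ℝ) ^ 2 ≤ 1 := by
      intro j _
      rw [sq_le_one_iff_abs_le_one]
      exact_mod_cast hM v j
    refine (Finset.sum_le_card_nsmul _ _ _ this).trans (le_of_eq ?_)
    simp [hn]
  have hXv : (X v : ℝ) = 2 * n ^ 2 * x₀ v + ∑ j, (M v j : ℝ) * Y j := by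
    rw [hX v, hn]
    push_cast
    rfl
  have hyv := hy.1 v
  obtain ⟨h1, h2⟩ := hy.2 v
  rw [← hn] at h1 h2
  have h1' : n ≤ 2 * n ^ 2 * y v := by nlinarith
  have h2' : 2 * n ^ 2 * y v ≤ 2 * n ^ 2 * lam - n := by nlinarith
  have hin : ∑ j, (M v j : ℝ) * Y j - 2 * n ^ 2 * ∑ j, (M v j : ℝ) * y j =
      X v - 2 * n ^ 2 * y v := by
    rw [hXv]
    linear_combination (2 * n ^ 2) * hyv
  rw [hin]
  rcases hσ with ⟨h, hv⟩ | ⟨h, hv⟩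
  · have : (X v : ℝ) < 0 := by exact_mod_cast hv
    rw [h]
    push_cast
    linarith
  · have : 2 * n ^ 2 * lam < (X v : ℝ) := by
      rw [hn]
      exact_mod_cast hv
    rw [h]
    push_cast
    linarith

/-- Adding row v of `M` to Y adds row v of the Gram matrix `M * Mᵀ` to X. A violated coordinate
rules out the first alternative of the invariant. -/
theorem RelaxInv.step {M : Matrix ι ι ℤ} (hM : ∀ i j, |M i j| ≤ 1) {x₀ : ι → ℤ} {lam t : ℕ}
    {X : ι → ℤ} (h : RelaxInv M x₀ lam t X) {v : ι} {σ : ℤ}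
    (hσ : (σ = 1 ∧ X v < 0) ∨ (σ = -1 ∧ 2 * (Fintype.card ι : ℤ) ^ 2 * lam < X v)) :
    RelaxInv M x₀ lam (t + 1) fun k => X k + σ * ∑ j, M v j * M k j := by
  obtain ⟨Y, hX, hY⟩ := h
  refine ⟨fun j => Y j + σ * M v j, fun k => ?_, Or.inr fun y hy => ?_⟩
  · simp only [hX k, mul_add, Finset.sum_add_distrib, Finset.mul_sum, add_assoc]
    congr 2
    exact Finset.sum_congr rfl fun j _ => by ring
  · rcases hY with hY | hY
    · have := hY v
      rcases hσ with ⟨_, hv⟩ | ⟨_, hv⟩ <;> omega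
    · have := potential_step hM hX hσ hy
      have := hY y hy
      push_cast at *
      linarith

/-- Lets the loop run for a fixed number of rounds: once the bounds hold, the remaining rounds leave
X alone. -/
theorem RelaxInv.feasible {M : Matrix ι ι ℤ} {x₀ : ι → ℤ} {lam t : ℕ} {X : ι → ℤ}
    (h : RelaxInv M x₀ lam t X) (hX : ∀ k, 0 ≤ X k ∧ X k ≤ 2 * (Fintype.card ι : ℤ) ^ 2 * lam) :
    RelaxInv M x₀ lam (t + 1) X := by
  obtain ⟨Y, hY, _⟩ := h
  exact ⟨Y, hY, Or.inl hX⟩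

/-- After 4n⁴λ² rounds the budget 4n⁵λ² - tn is zero; one further correction would make a sum of
squares at most -n. -/
theorem RelaxInv.no_deep_point {M : Matrix ι ι ℤ} (hM : ∀ i j, |M i j| ≤ 1) {x₀ : ι → ℤ}
    {lam : ℕ} {X : ι → ℤ} (h : RelaxInv M x₀ lam (4 * Fintype.card ι ^ 4 * lam ^ 2) X) {v : ι}
    {σ : ℤ} (hσ : (σ = 1 ∧ X v < 0) ∨ (σ = -1 ∧ 2 * (Fintype.card ι : ℤ) ^ 2 * lam < X v))
    (y : ι → ℝ) : ¬ IsDeepPoint M x₀ lam y := by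
  intro hy
  obtain ⟨Y, hX, hY | hY⟩ := h
  · have := hY v
    rcases hσ with ⟨_, hv⟩ | ⟨_, hv⟩ <;> omega
  · have h1 := potential_step hM hX hσ hy
    have h2 := hY y hy
    have h3 : (0 : ℝ) ≤
        ∑ j, (((Y j + σ * M v j : ℤ) : ℝ) - 2 * (Fintype.card ι : ℝ) ^ 2 * y j) ^ 2 :=
      Finset.sum_nonneg fun _ _ => sq_nonneg _
    have hn : (0 : ℝ) < Fintype.card ι := by exact_mod_cast Fintype.card_pos_iff.2 ⟨v⟩
    push_cast at h2
    nlinarith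

end Relaxation

/-! ### A program logic with step counts and bounds on number sizes. -/

namespace RatRAM

infixr:60 " ;; " => Prog.seq

/-- The program `P`, started in `s`, halts after at most `t` steps in a memory satisfying `Q`, and
the numbers it writes have encoding lengths of the order of that of `B`. -/
def Wp (P : Prog) (t B : ℕ) (s : Mem) (Q : Mem → Prop) : Prop :=
  ∃ t' w s', Exec P s t' w s' ∧ t' ≤ t ∧ w ≤ 2 * B.size + 5 ∧ Q s'

theorem bitSize_intCast_le {z : ℤ} {B : ℕ} (h : |z| ≤ B) : bitSize (z : ℚ) ≤ 2 * B.size + 5 := by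
  rw [Int.abs_eq_natAbs] at h
  have h1 : z.natAbs.size ≤ B.size := Nat.size_le_size (by omega)
  have h2 : Nat.size 1 = 1 := by decide
  simp only [bitSize, Rat.num_intCast, Rat.den_intCast, h2]
  omega

/-- Reduction to lowest terms only replaces numerator and denominator by divisors. -/
theorem bitSize_div_le {x : ℤ} {y B : ℕ} (hx : |x| ≤ B) (hy : 0 < y) (hyB : y ≤ B) :
    bitSize ((x : ℚ) / (y : ℚ)) ≤ 2 * B.size + 5 := by
  have hy' : (y : ℤ) ≠ 0 := by omega
  rw [Int.abs_eq_natAbs] at hx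
  have hden : ((x : ℚ) / (y : ℚ)).den ∣ y := by
    have := Rat.den_dvd x y
    exact_mod_cast this
  have hd : ((x : ℚ) / (y : ℚ)).den ≤ y := Nat.le_of_dvd hy hden
  have hnum : ((x : ℚ) / (y : ℚ)).num ∣ x := by
    have := Rat.num_dvd x hy'
    exact_mod_cast this
  have hn : ((x : ℚ) / (y : ℚ)).num.natAbs ≤ x.natAbs := by
    rcases eq_or_ne x 0 with rfl | hx0
    · simp
    · exact Nat.le_of_dvd (Int.natAbs_pos.2 hx0) (Int.natAbs_dvd_natAbs.2 hnum)
  have h1 := Nat.size_le_size (show ((x : ℚ) / (y : ℚ)).num.natAbs ≤ B by omega)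
  have h2 := Nat.size_le_size (show ((x : ℚ) / (y : ℚ)).den ≤ B by omega)
  simp only [bitSize]
  omega

namespace Wp

variable {P R : Prog} {s : Mem} {Q : Mem → Prop} {t t₁ t₂ B a c d k : ℕ}

theorem weaken {Q' : Mem → Prop} (h : Wp P t₁ B s Q') (ht : t₁ ≤ t) (hQ : ∀ s', Q' s' → Q s') :
    Wp P t B s Q := by
  obtain ⟨t', w, s', h1, h2, h3, h4⟩ := h
  exact ⟨t', w, s', h1, h2.trans ht, h3, hQ _ h4⟩

theorem skip (h : Q s) : Wp .skip t B s Q := ⟨0, 0, s, .skip s, by omega, by omega, h⟩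

theorem seq {Q' : Mem → Prop} (h : Wp P t₁ B s Q') (h' : ∀ s', Q' s' → Wp R t₂ B s' Q) :
    Wp (P ;; R) (t₂ + t₁) B s Q := by
  obtain ⟨t', w, s', h1, h2, h3, h4⟩ := h
  obtain ⟨t'', w', s'', h1', h2', h3', h4'⟩ := h' s' h4
  exact ⟨_, _, s'', .seq h1 h1', by omega, by omega, h4'⟩

theorem const (z : ℤ) (hz : |z| ≤ B) (h : Wp R t B (s.setReg d z) Q) :
    Wp (.const d z ;; R) (t + 1) B s Q :=
  seq (Q' := fun s' => s' = s.setReg d z)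
    ⟨1, _, _, .const s d z, le_rfl, bitSize_intCast_le hz, rfl⟩ fun _ e => e ▸ h

theorem add (z : ℤ) (hv : s.reg a + s.reg c = z) (hz : |z| ≤ B)
    (h : Wp R t B (s.setReg d z) Q) : Wp (.arith .add d a c ;; R) (t + 1) B s Q :=
  seq (Q' := fun s' => s' = s.setReg d z)
    ⟨1, _, _, .arith s .add d a c z (by simp [ArithOp.eval, hv]), le_rfl, bitSize_intCast_le hz,
      rfl⟩ fun _ e => e ▸ h

theorem sub (z : ℤ) (hv : s.reg a - s.reg c = z) (hz : |z| ≤ B)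
    (h : Wp R t B (s.setReg d z) Q) : Wp (.arith .sub d a c ;; R) (t + 1) B s Q :=
  seq (Q' := fun s' => s' = s.setReg d z)
    ⟨1, _, _, .arith s .sub d a c z (by simp [ArithOp.eval, hv]), le_rfl, bitSize_intCast_le hz,
      rfl⟩ fun _ e => e ▸ h

theorem mul (z : ℤ) (hv : s.reg a * s.reg c = z) (hz : |z| ≤ B)
    (h : Wp R t B (s.setReg d z) Q) : Wp (.arith .mul d a c ;; R) (t + 1) B s Q :=
  seq (Q' := fun s' => s' = s.setReg d z)
    ⟨1, _, _, .arith s .mul d a c z (by simp [ArithOp.eval, hv]), le_rfl, bitSize_intCast_le hz,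
      rfl⟩ fun _ e => e ▸ h

theorem addNat (z : ℕ) (hv : s.reg a + s.reg c = z) (hz : z ≤ B)
    (h : Wp R t B (s.setReg d z) Q) : Wp (.arith .add d a c ;; R) (t + 1) B s Q :=
  add z (by simpa using hv) (by simpa using hz) (by simpa using h)

theorem mulNat (z : ℕ) (hv : s.reg a * s.reg c = z) (hz : z ≤ B)
    (h : Wp R t B (s.setReg d z) Q) : Wp (.arith .mul d a c ;; R) (t + 1) B s Q :=
  mul z (by simpa using hv) (by simpa using hz) (by simpa using h)

theorem div (x : ℤ) (y : ℕ) (hx : s.reg a = x) (hy : s.reg c = y) (hxB : |x| ≤ B) (hy0 : 0 < y)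
    (hyB : y ≤ B) (h : Wp R t B (s.setReg d (x / y)) Q) :
    Wp (.arith .div d a c ;; R) (t + 1) B s Q :=
  seq (Q' := fun s' => s' = s.setReg d (x / y))
    ⟨1, _, _, .arith s .div d a c (x / y) (by simp [ArithOp.eval, hx, hy, hy0.ne']), le_rfl,
      bitSize_div_le hxB hy0 hyB, rfl⟩ fun _ e => e ▸ h

theorem load (i : ℕ) (z : ℤ) (hi : s.reg a = i) (hv : s.arr k i = z) (hz : |z| ≤ B)
    (h : Wp R t B (s.setReg d z) Q) : Wp (.load d k a ;; R) (t + 1) B s Q :=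
  seq (Q' := fun s' => s' = s.setReg d z)
    ⟨1, _, _, .load s d k a i hi, le_rfl, hv ▸ bitSize_intCast_le hz, by rw [hv]⟩
    fun _ e => e ▸ h

theorem store (i : ℕ) (z : ℤ) (hi : s.reg a = i) (hv : s.reg c = z) (hz : |z| ≤ B)
    (h : Wp R t B (s.setArr k i z) Q) : Wp (.store k a c ;; R) (t + 1) B s Q :=
  seq (Q' := fun s' => s' = s.setArr k i z)
    ⟨1, _, _, .store s k a c i hi, le_rfl, hv ▸ bitSize_intCast_le hz, by rw [hv]⟩
    fun _ e => e ▸ h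

theorem storeQuot (i : ℕ) (x : ℤ) (y : ℕ) (hi : s.reg a = i) (hv : s.reg c = x / y)
    (hxB : |x| ≤ B) (hy0 : 0 < y) (hyB : y ≤ B) (h : Wp R t B (s.setArr k i (x / y)) Q) :
    Wp (.store k a c ;; R) (t + 1) B s Q :=
  seq (Q' := fun s' => s' = s.setArr k i (x / y))
    ⟨1, _, _, .store s k a c i hi, le_rfl, hv ▸ bitSize_div_le hxB hy0 hyB, by rw [hv]⟩
    fun _ e => e ▸ h

theorem ite (hP : s.reg a < s.reg c → Wp P t B s Q) (hR : ¬ s.reg a < s.reg c → Wp R t B s Q) :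
    Wp (.ifLt a c P R) (t + 1) B s Q := by
  by_cases h : s.reg a < s.reg c
  · obtain ⟨t', w, s', h1, h2, h3, h4⟩ := hP h
    exact ⟨_, _, _, .ifLt_true h h1, by omega, h3, h4⟩
  · obtain ⟨t', w, s', h1, h2, h3, h4⟩ := hR h
    exact ⟨_, _, _, .ifLt_false h h1, by omega, h3, h4⟩

end Wp

/-- The registers below `L` have the same contents. -/
def Agree (L : ℕ) (s s' : Mem) : Prop := ∀ r < L, s'.reg r = s.reg r

theorem Agree.refl (L : ℕ) (s : Mem) : Agree L s s := fun _ _ => rfl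

theorem Agree.trans {L : ℕ} {s₁ s₂ s₃ : Mem} (h : Agree L s₁ s₂) (h' : Agree L s₂ s₃) :
    Agree L s₁ s₃ := fun r hr => (h' r hr).trans (h r hr)

theorem Agree.mono {L L' : ℕ} {s₁ s₂ : Mem} (h : Agree L s₁ s₂) (hL : L' ≤ L) : Agree L' s₁ s₂ :=
  fun r hr => h r (hr.trans_le hL)

theorem Agree.setReg {L d : ℕ} {s₁ s₂ : Mem} {v : ℚ} (h : Agree L s₁ s₂) (hd : L ≤ d) :
    Agree L s₁ (s₂.setReg d v) := fun r hr => by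
  simp [Mem.setReg, Function.update_of_ne (show r ≠ d by omega), h r hr]

theorem Agree.setArr {L k i : ℕ} {s₁ s₂ : Mem} {v : ℚ} (h : Agree L s₁ s₂) :
    Agree L s₁ (s₂.setArr k i v) := h

/-- Run `P` for all values of the register `i` from `0` up to the content of register `N` minus one.
Register 4 has to hold the number one. -/
def forTo (i N : ℕ) (P : Prog) : Prog :=
  .const i 0 ;; .whileLt i N (P ;; .arith .add i i 4)

/-- `J j` is the invariant after j rounds; `hJ` makes it independent of the counter. The body must
preserve all registers below `L`, among them the bound `N` and the constant one, as well as the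
counter. Each round pays for its test and increment; the final 2 is the initialization and the last
test. -/
theorem Wp.forTo {P : Prog} {s₀ : Mem} {Q : Mem → Prop} {t B L i N k : ℕ}
    (J : ℕ → Mem → Prop) (hL : 5 ≤ L) (hi : L ≤ i) (hN : N < L) (h4 : s₀.reg 4 = 1)
    (hk : s₀.reg N = k) (hkB : k ≤ B)
    (hJ : ∀ j s v, J j s → J j (s.setReg i v)) (h0 : J 0 s₀)
    (hP : ∀ j s, j < k → Agree L s₀ s → s.reg i = j → J j s →
      Wp P t B s fun s' => Agree L s s' ∧ s'.reg i = j ∧ J (j + 1) s')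
    (hQ : ∀ s, Agree L s₀ s → J k s → Q s) :
    Wp (RatRAM.forTo i N P) (k * (t + 2) + 2) B s₀ Q := by
  have loop : ∀ l j s, j + l = k → Agree L s₀ s → s.reg i = j → J j s →
      Wp (.whileLt i N (P ;; .arith .add i i 4)) (l * (t + 2) + 1) B s Q := by
    intro l
    induction l with
    | zero =>
      intro j s hj hA hij hs
      obtain rfl : j = k := by omega
      refine ⟨1, 0, s, .whileLt_false ?_, by omega, by omega, hQ s hA hs⟩
      rw [hij, hA N hN, hk]
      exact lt_irrefl _
    | succ l ih =>
      intro j s hj hA hij hs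
      obtain ⟨t', w, s', h1, h2, h3, hA', hij', hs'⟩ := hP j s (by omega) hA hij hs
      have hval : s'.reg i + s'.reg 4 = ((j + 1 : ℕ) : ℚ) := by
        rw [hij', hA' 4 (by omega), hA 4 (by omega), h4]
        push_cast
        rfl
      obtain ⟨t'', w', s'', h1', h2', h3', h4'⟩ := ih (j + 1) (s'.setReg i ((j + 1 : ℕ) : ℚ))
        (by omega) ((hA.trans hA').setReg hi) (by simp [Mem.setReg]) (hJ _ _ _ hs')
      refine ⟨_, _, s'', .whileLt_true ?_ (.seq h1 (.arith s' .add i i 4 ((j + 1 : ℕ) : ℚ) ?_)) h1',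
        ?_, ?_, h4'⟩
      · rw [hij, hA N hN, hk]
        exact_mod_cast (by omega : j < k)
      · simp [ArithOp.eval, hval]
      · rw [Nat.succ_mul]
        omega
      · have : bitSize ((j + 1 : ℕ) : ℚ) ≤ 2 * B.size + 5 := by
          have := bitSize_intCast_le (z := ((j + 1 : ℕ) : ℤ)) (B := B) 
            (by rw [Nat.abs_cast]; exact_mod_cast (by omega : j + 1 ≤ B))
          simpa using this
        omega
  have hc := Wp.const (R := .whileLt i N (P ;; .arith .add i i 4)) (s := s₀) (d := i) (B := B) 0
    (by simp) (loop k 0 (s₀.setReg i ((0 : ℤ) : ℚ)) (by omega) ((Agree.refl L s₀).setReg hi)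
      (by simp [Mem.setReg]) (hJ _ _ _ h0))
  simpa [RatRAM.forTo] using hc

/-- The array `f` holds the vector `z`. -/
def IsVec (f : ℕ → ℚ) (R : ℕ) (z : ℕ → ℤ) : Prop := ∀ i < R, f i = z i

/-- The array `f` holds the matrix `T`, row by row. -/
def IsMat (f : ℕ → ℚ) (R c : ℕ) (T : ℕ → ℕ → ℤ) : Prop :=
  ∀ i < R, ∀ j < c, f (i * c + j) = T i j

theorem IsVec.congr {f : ℕ → ℚ} {R : ℕ} {z z' : ℕ → ℤ} (h : IsVec f R z)
    (hz : ∀ i < R, z i = z' i) : IsVec f R z' := fun i hi => by rw [h i hi, hz i hi]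

theorem IsMat.congr {f : ℕ → ℚ} {R c : ℕ} {T T' : ℕ → ℕ → ℤ} (h : IsMat f R c T)
    (hT : ∀ i < R, ∀ j < c, T i j = T' i j) : IsMat f R c T' :=
  fun i hi j hj => by rw [h i hi j hj, hT i hi j hj]

theorem IsVec.update {f : ℕ → ℚ} {R : ℕ} {z : ℕ → ℤ} (h : IsVec f R z) (i : ℕ) (v : ℤ) :
    IsVec (Function.update f i v) R fun i' => if i' = i then v else z i' := by
  intro i' hi'
  by_cases e : i' = i
  · simp [e]
  · simp [e, h i' hi']

theorem index_inj {c i j i' j' : ℕ} (hj : j < c) (hj' : j' < c) (h : i' * c + j' = i * c + j) :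
    i' = i ∧ j' = j := by
  have h1 : (i' * c + j') / c = i' := by
    rw [mul_comm, Nat.mul_add_div (by omega), Nat.div_eq_of_lt hj', add_zero]
  have h2 : (i * c + j) / c = i := by
    rw [mul_comm, Nat.mul_add_div (by omega), Nat.div_eq_of_lt hj, add_zero]
  rw [h, h2] at h1
  subst h1
  exact ⟨rfl, by omega⟩

theorem IsMat.update {f : ℕ → ℚ} {R c : ℕ} {T : ℕ → ℕ → ℤ} (h : IsMat f R c T) (i : ℕ) {j : ℕ}
    (hj : j < c) (v : ℤ) :
    IsMat (Function.update f (i * c + j) v) R c fun i' j' => if i' = i ∧ j' = j then v else T i' j' := by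
  intro i' hi' j' hj'
  by_cases e : i' = i ∧ j' = j
  · simp [e]
  · have : i' * c + j' ≠ i * c + j := fun h' => e (index_inj hj hj' h')
    simp [e, Function.update_of_ne this, h i' hi' j' hj']

theorem index_lt {R c i j : ℕ} (hi : i < R) (hj : j < c) : i * c + j < R * c := by
  nlinarith

end RatRAM

/-! ### Subprograms for set-up and elimination. -/

namespace RatRAM

/-- Contents of the registers that stay fixed after the set-up phase. -/
structure Env (m n lam : ℕ) (s : Mem) : Prop where
  r0 : s.reg 0 = m
  r1 : s.reg 1 = n
  r3 : s.reg 3 = 0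
  r4 : s.reg 4 = 1
  r5 : s.reg 5 = (m + n : ℕ)
  r6 : s.reg 6 = (2 * n ^ 2 : ℕ)
  r7 : s.reg 7 = (2 * n ^ 2 * lam : ℕ)
  r8 : s.reg 8 = (4 * n ^ 4 * lam ^ 2 : ℕ)

theorem Env.of_agree {m n lam L : ℕ} {s s' : Mem} (h : Env m n lam s) (hA : Agree L s s')
    (hL : 10 ≤ L) : Env m n lam s' := by
  obtain ⟨h0, h1, h3, h4, h5, h6, h7, h8⟩ := h
  exact ⟨(hA 0 (by omega)).trans h0, (hA 1 (by omega)).trans h1, (hA 3 (by omega)).trans h3,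
    (hA 4 (by omega)).trans h4, (hA 5 (by omega)).trans h5, (hA 6 (by omega)).trans h6,
    (hA 7 (by omega)).trans h7, (hA 8 (by omega)).trans h8⟩

/-- Compute the fixed registers. -/
def setup : Prog :=
  .const 4 1 ;; .arith .add 5 0 1 ;; .arith .mul 9 1 1 ;; .arith .add 6 9 9 ;;
  .arith .mul 7 6 2 ;; .arith .mul 8 7 7 ;; .skip

theorem wp_setup {m n lam B : ℕ} {s : Mem} (h0 : s.reg 0 = m) (h1 : s.reg 1 = n)
    (h2 : s.reg 2 = lam) (h3 : s.reg 3 = 0) (hB1 : 1 ≤ B) (hB5 : m + n ≤ B)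
    (hB6 : 2 * n ^ 2 ≤ B) (hB7 : 2 * n ^ 2 * lam ≤ B) (hB8 : 4 * n ^ 4 * lam ^ 2 ≤ B) :
    Wp setup 6 B s fun s' => Env m n lam s' ∧ s'.arr = s.arr := by
  refine .const 1 (by simpa using hB1) ?_
  refine .addNat (m + n) (by simp [Mem.setReg, h0, h1]) hB5 ?_
  refine .mulNat (n ^ 2) (by simp [Mem.setReg, h1, sq]) (by omega) ?_
  refine .addNat (2 * n ^ 2) (by simp [Mem.setReg]; ring) hB6 ?_
  refine .mulNat (2 * n ^ 2 * lam) (by simp [Mem.setReg, h2]) hB7 ?_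
  refine .mulNat (4 * n ^ 4 * lam ^ 2) (by simp [Mem.setReg]; ring) hB8 ?_
  refine .skip ⟨?_, rfl⟩
  constructor <;> simp [Mem.setReg, h0, h1, h3]

/-- Write an identity matrix below the matrix in array 0. -/
def putIdentity : Prog :=
  forTo 10 1 (.arith .add 11 0 10 ;; .arith .mul 11 11 1 ;; .arith .add 11 11 10 ;;
    .store 0 11 4 ;; .skip)

theorem wp_putIdentity {m n lam B : ℕ} {s : Mem} (E : Env m n lam s) {T : ℕ → ℕ → ℤ}
    (hT : IsMat (s.arr 0) (m + n) n T) (hB : (m + n) * n + m + n + 1 ≤ B) :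
    Wp putIdentity (n * (4 + 2) + 2) B s fun s' => Agree 10 s s' ∧
      (∀ k, k ≠ 0 → s'.arr k = s.arr k) ∧
      IsMat (s'.arr 0) (m + n) n fun i j => if i = m + j then 1 else T i j := by
  refine Wp.forTo (L := 10) (k := n) (fun l s' => (∀ k, k ≠ 0 → s'.arr k = s.arr k) ∧
    IsMat (s'.arr 0) (m + n) n fun i j => if i = m + j ∧ j < l then 1 else T i j)
    (by omega) (by omega) (by omega) E.r4 E.r1 (by omega) (fun _ _ _ h => h)
    ⟨fun _ _ => rfl, by simpa using hT⟩ ?_ ?_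
  · intro i s₁ hi hA hi' hJ
    have E' := E.of_agree hA le_rfl
    have hlt : (m + i) * n + i < (m + n) * n := index_lt (by omega) hi
    refine .addNat (m + i) (by simp [E'.r0, hi']) (by omega) ?_
    refine .mulNat ((m + i) * n) (by simp [Mem.setReg, E'.r1]) (by omega) ?_
    refine .addNat ((m + i) * n + i) (by simp [Mem.setReg, hi']) (by omega) ?_
    refine .store ((m + i) * n + i) 1 (by simp [Mem.setReg]) (by simp [Mem.setReg, E'.r4])
      (by simp; omega) ?_
    refine .skip ⟨?_, by simp [Mem.setReg, Mem.setArr, hi'], ?_, ?_⟩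
    · exact ((((Agree.refl _ _).setReg (by omega)).setReg (by omega)).setReg (by omega)).setArr
    · intro k hk
      simp [Mem.setReg, Mem.setArr, hk, hJ.1 k hk]
    · have := hJ.2.update (m + i) hi 1
      simp only [Mem.setReg, Mem.setArr, Function.update_self]
      refine this.congr fun i' _ j' _ => ?_
      split_ifs <;> first | rfl | (exfalso; omega)
  · intro s' hA hJ
    refine ⟨hA, hJ.1, hJ.2.congr fun i _ j hj => ?_⟩
    simp [hj]

/-- Copy the row given by register 10 of the matrix in array 0 to array 5, and put a non-zero entry
of it and the column of this entry into the registers 12 and 13. -/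
def findPivot : Prog :=
  .arith .mul 11 10 1 ;; .const 12 0 ;; .const 13 0 ;;
  forTo 20 1 (.arith .add 21 11 20 ;; .load 22 0 21 ;; .store 5 20 22 ;; .arith .mul 23 22 22 ;;
    -- With `<` as the only test, an entry is recognized as non-zero by its square being positive;
    -- adding register 3, which holds zero, copies a register.
    .ifLt 3 23 (.arith .add 12 22 3 ;; .arith .add 13 20 3 ;; .skip) .skip)

theorem wp_findPivot {m n lam B r : ℕ} {s : Mem} (E : Env m n lam s) (hn : 0 < n)
    {T : ℕ → ℕ → ℤ} (hT : IsMat (s.arr 0) (m + n) n T)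
    (hT1 : ∀ i < m + n, ∀ j < n, |T i j| ≤ 1) (hr : r < m) (h10 : s.reg 10 = r)
    (hB : (m + n) * n + m + n + 1 ≤ B) :
    Wp findPivot (n * (7 + 2) + 2 + 3) B s fun s' => Agree 11 s s' ∧
      (∀ k, k ≠ 5 → s'.arr k = s.arr k) ∧ IsVec (s'.arr 5) n (T r) ∧
      ∃ c < n, s'.reg 12 = T r c ∧ s'.reg 13 = c ∧ (T r c = 0 → ∀ j < n, T r j = 0) := by
  have hrn : r * n + 0 < (m + n) * n := index_lt (by omega) hn
  refine .mulNat (r * n) (by simp [h10, E.r1]) (by omega) ?_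
  refine .const 0 (by simp) ?_
  refine .const 0 (by simp) ?_
  set s₀ : Mem := ((s.setReg 11 (r * n : ℕ)).setReg 12 (0 : ℤ)).setReg 13 (0 : ℤ) with hs₀
  have hA₀ : Agree 11 s s₀ :=
    (((Agree.refl _ _).setReg (by omega)).setReg (by omega)).setReg (by omega)
  have E₀ := E.of_agree hA₀ (by omega)
  have h11 : s₀.reg 11 = (r * n : ℕ) := by simp [hs₀, Mem.setReg]
  refine Wp.forTo (L := 12) (k := n) (fun l s' => (∀ k, k ≠ 5 → s'.arr k = s.arr k) ∧
    (∀ j < l, s'.arr 5 j = T r j) ∧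
      ((s'.reg 12 = 0 ∧ s'.reg 13 = 0 ∧ ∀ j < l, T r j = 0) ∨
        ∃ c < n, s'.reg 12 = T r c ∧ s'.reg 13 = c ∧ T r c ≠ 0))
    (by omega) (by omega) (by omega) E₀.r4 E₀.r1 (by omega) ?_ ?_ ?_ ?_
  · intro j s' v h
    simpa [Mem.setReg] using h
  · refine ⟨fun _ _ => rfl, by simp, Or.inl ?_⟩
    simp [hs₀, Mem.setReg]
  · intro j s₁ hj hA hj' hJ
    have E' := E₀.of_agree hA (by omega)
    have h11' : s₁.reg 11 = (r * n : ℕ) := (hA 11 (by omega)).trans h11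
    have hlt : r * n + j < (m + n) * n := index_lt (by omega) hj
    have hv : s₁.arr 0 (r * n + j) = T r j := by
      rw [hJ.1 0 (by omega)]
      exact hT r (by omega) j hj
    have hTj := hT1 r (by omega) j hj
    refine .addNat (r * n + j) (by simp [h11', hj']) (by omega) ?_
    refine .load (r * n + j) (T r j) (by simp [Mem.setReg]) (by simp [Mem.setReg, hv])
      (by omega) ?_
    refine .store j (T r j) (by simp [Mem.setReg, hj']) (by simp [Mem.setReg]) (by omega) ?_
    refine .mul (T r j * T r j) (by simp [Mem.setReg, Mem.setArr])
      (by rw [abs_mul]; nlinarith [abs_nonneg (T r j)]) ?_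
    have hvec : ∀ l < j + 1, (Function.update (s₁.arr 5) j (T r j : ℚ)) l = T r l := by
      intro l hl
      by_cases e : l = j
      · simp [e]
      · simp [e, hJ.2.1 l (by omega)]
    refine .ite (t := 2) ?_ ?_
    · intro hlt'
      have hne : T r j ≠ 0 := by
        intro h
        simp [Mem.setReg, Mem.setArr, E'.r3, h] at hlt'
      refine .add (T r j) (by simp [Mem.setReg, Mem.setArr, E'.r3]) (by omega) ?_
      refine .addNat j (by simp [Mem.setReg, Mem.setArr, E'.r3, hj']) (by omega) ?_
      refine .skip ⟨?_, by simp [Mem.setReg, Mem.setArr, hj'], ?_, ?_, ?_⟩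
      · repeat first | exact Agree.refl _ _ | apply Agree.setArr | refine Agree.setReg ?_ (by omega)
      · intro k hk
        simp [Mem.setReg, Mem.setArr, hk, hJ.1 k hk]
      · simpa [Mem.setReg, Mem.setArr] using hvec
      · exact Or.inr ⟨j, hj, by simp [Mem.setReg], by simp [Mem.setReg], hne⟩
    · intro hlt'
      have hz : T r j = 0 := by simpa [Mem.setReg, Mem.setArr, E'.r3] using hlt'
      refine .skip ⟨?_, by simp [Mem.setReg, Mem.setArr, hj'], ?_, ?_, ?_⟩
      · repeat first | exact Agree.refl _ _ | apply Agree.setArr | refine Agree.setReg ?_ (by omega)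
      · intro k hk
        simp [Mem.setReg, Mem.setArr, hk, hJ.1 k hk]
      · simpa [Mem.setReg, Mem.setArr] using hvec
      · rcases hJ.2.2 with ⟨h1, h2, h3⟩ | ⟨c, hc, h1, h2, h3⟩
        · refine Or.inl ⟨by simpa [Mem.setReg, Mem.setArr] using h1,
            by simpa [Mem.setReg, Mem.setArr] using h2, fun l hl => ?_⟩
          rcases Nat.lt_succ_iff_lt_or_eq.1 hl with h | rfl
          · exact h3 l h
          · exact hz
        · exact Or.inr ⟨c, hc, by simpa [Mem.setReg, Mem.setArr] using h1,
            by simpa [Mem.setReg, Mem.setArr] using h2, h3⟩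
  · intro s' hA hJ
    refine ⟨hA₀.trans (hA.mono (by omega)), hJ.1, hJ.2.1, ?_⟩
    rcases hJ.2.2 with ⟨h1, h2, h3⟩ | ⟨c, hc, h1, h2, h3⟩
    -- A zero row yields the pivot value 0 in column 0, for which the subsequent elimination is the
    -- identity.
    · exact ⟨0, hn, by simp [h1, h3 0 hn], by simp [h2], fun _ => h3⟩
    · exact ⟨c, hc, h1, h2, fun h => absurd h h3⟩

/-- Subtract a multiple of array 5 from the row at address register 21 of the matrix in array 0. The
factor is in register 23. -/
def updateRow : Prog :=
  forTo 30 1 (.arith .add 31 21 30 ;; .load 32 0 31 ;; .load 33 5 30 ;; .arith .mul 33 33 23 ;;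
    .arith .sub 32 32 33 ;; .store 0 31 32 ;; .skip)

theorem wp_updateRow {m n lam B i : ℕ} {s : Mem} (E : Env m n lam s)
    {T : ℕ → ℕ → ℤ} (hT : IsMat (s.arr 0) (m + n) n T) {V : ℕ → ℤ} (hV : IsVec (s.arr 5) n V)
    {f : ℤ} (hi : i < m + n) (hT1 : ∀ j < n, |T i j| ≤ 1) (hV1 : ∀ j < n, |V j| ≤ 1)
    (hf1 : |f| ≤ 1) (h21 : s.reg 21 = (i * n : ℕ)) (h23 : s.reg 23 = f)
    (hB : (m + n) * n + m + n + 1 ≤ B) :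
    Wp updateRow (n * (6 + 2) + 2) B s fun s' => Agree 30 s s' ∧
      (∀ k, k ≠ 0 → s'.arr k = s.arr k) ∧
      IsMat (s'.arr 0) (m + n) n fun i' j' => if i' = i then T i' j' - V j' * f else T i' j' := by
  refine Wp.forTo (L := 30) (k := n) (fun l s' => (∀ k, k ≠ 0 → s'.arr k = s.arr k) ∧
    IsMat (s'.arr 0) (m + n) n fun i' j' => if i' = i ∧ j' < l then T i' j' - V j' * f else T i' j')
    (by omega) (by omega) (by omega) E.r4 E.r1 (by omega) (fun _ _ _ h => h)
    ⟨fun _ _ => rfl, by simpa using hT⟩ ?_ ?_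
  · intro j s₁ hj hA hj' hJ
    have E' := E.of_agree hA (by omega)
    have h21' := (hA 21 (by omega)).trans h21
    have h23' := (hA 23 (by omega)).trans h23
    have hlt : i * n + j < (m + n) * n := index_lt hi hj
    have hv : s₁.arr 0 (i * n + j) = T i j := by
      simpa using hJ.2 i hi j hj
    have hTj := hT1 j hj
    have hVj := hV1 j hj
    have hVf : |V j * f| ≤ 1 := by
      rw [abs_mul]
      exact mul_le_one₀ hVj (abs_nonneg _) hf1
    have hn : 0 < n := by omega
    have hn2 : 1 ≤ (m + n) * n := by omega
    -- The crude bound 2 is enough for number sizes; that the new entries are again at most 1 comes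
    -- from total unimodularity later.
    have hd : |T i j - V j * f| ≤ 2 := (abs_sub _ _).trans (by omega)
    refine .addNat (i * n + j) (by simp [h21', hj']) (by omega) ?_
    refine .load (i * n + j) (T i j) (by simp [Mem.setReg]) (by simp [Mem.setReg, hv])
      (by omega) ?_
    refine .load j (V j) (by simp [Mem.setReg, hj'])
      (by simp [Mem.setReg, hJ.1 5, hV j hj]) (by omega) ?_
    refine .mul (V j * f) (by simp [Mem.setReg, h23']) (by omega) ?_
    refine .sub (T i j - V j * f) (by simp [Mem.setReg]) (by omega) ?_
    refine .store (i * n + j) (T i j - V j * f) (by simp [Mem.setReg]) (by simp [Mem.setReg])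
      (by omega) ?_
    refine .skip ⟨?_, by simp [Mem.setReg, Mem.setArr, hj'], ?_, ?_⟩
    · repeat first | exact Agree.refl _ _ | apply Agree.setArr | refine Agree.setReg ?_ (by omega)
    · intro k hk
      simp [Mem.setReg, Mem.setArr, hk, hJ.1 k hk]
    · have := hJ.2.update i hj (T i j - V j * f)
      simp only [Mem.setReg, Mem.setArr, Function.update_self]
      refine this.congr fun i' _ j' _ => ?_
      by_cases e : i' = i <;> by_cases e' : j' = j
      · simp [e, e']
      · have : j' < j ↔ j' < j + 1 := by omega
        simp [e, e', this]
      · simp [e]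
      · simp [e]
  · intro s' hA hJ
    refine ⟨hA, hJ.1, hJ.2.congr fun i' _ j hj => ?_⟩
    simp [hj]

/-- Rank one update of the matrix in array 0 and of the vector in array 1, after `findPivot`. -/
def eliminate : Prog :=
  .load 14 1 10 ;;
  forTo 20 5 (.arith .mul 21 20 1 ;; .arith .add 22 21 13 ;; .load 23 0 22 ;;
    .arith .mul 23 23 12 ;; .arith .mul 24 23 14 ;; .load 25 1 20 ;; .arith .sub 25 25 24 ;;
    .store 1 20 25 ;; updateRow)

/-- The pass also overwrites row r and its entry of the vector. The copies in array 5 and register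
14, and the pivot in register 12, keep the old values available for the rows treated afterwards. -/
theorem wp_eliminate {m n lam B r c Z : ℕ} {s : Mem} (E : Env m n lam s)
    {T : ℕ → ℕ → ℤ} (hT : IsMat (s.arr 0) (m + n) n T) {V : ℕ → ℤ} (hV : IsVec (s.arr 5) n V)
    {z : ℕ → ℤ} (hz : IsVec (s.arr 1) (m + n) z) {p : ℤ}
    (hT1 : ∀ i < m + n, ∀ j < n, |T i j| ≤ 1) (hV1 : ∀ j < n, |V j| ≤ 1) (hp : |p| ≤ 1)
    (hz1 : ∀ i < m + n, |z i| ≤ Z) (hr : r < m) (hc : c < n)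
    (h10 : s.reg 10 = r) (h12 : s.reg 12 = p) (h13 : s.reg 13 = c)
    (hB : (m + n) * n + m + n + 1 ≤ B) (hZB : 2 * Z ≤ B) :
    Wp eliminate ((m + n) * ((n * (6 + 2) + 2 + 8) + 2) + 2 + 1) B s fun s' => Agree 11 s s' ∧
      (∀ k, k ≠ 0 → k ≠ 1 → s'.arr k = s.arr k) ∧
      (IsMat (s'.arr 0) (m + n) n fun i j => T i j - V j * (T i c * p)) ∧
      IsVec (s'.arr 1) (m + n) fun i => z i - T i c * p * z r := by
  have hzr := hz1 r (by omega)
  refine .load r (z r) h10 (hz r (by omega)) (by omega) ?_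
  set s₀ : Mem := s.setReg 14 (z r) with hs₀
  have hA₀ : Agree 14 s s₀ := (Agree.refl _ _).setReg (by omega)
  have E₀ := E.of_agree hA₀ (by omega)
  have h14 : s₀.reg 14 = z r := by simp [hs₀, Mem.setReg]
  refine Wp.forTo (L := 15) (k := m + n) (fun l s' => (∀ k, k ≠ 0 → k ≠ 1 → s'.arr k = s.arr k) ∧
    (IsMat (s'.arr 0) (m + n) n fun i j => if i < l then T i j - V j * (T i c * p) else T i j) ∧
    IsVec (s'.arr 1) (m + n) fun i => if i < l then z i - T i c * p * z r else z i)
    (by omega) (by omega) (by omega) E₀.r4 E₀.r5 (by omega) (fun _ _ _ h => h) ?_ ?_ ?_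
  · exact ⟨fun _ _ _ => rfl, hT.congr (by simp), hz.congr (by simp)⟩
  · intro i s₁ hi hA hi' hJ
    obtain ⟨hJ0, hJT, hJz⟩ := hJ
    have E' := E₀.of_agree hA (by omega)
    have h12' : s₁.reg 12 = p := ((hA 12 (by omega)).trans (hA₀ 12 (by omega))).trans h12
    have h13' : s₁.reg 13 = c := ((hA 13 (by omega)).trans (hA₀ 13 (by omega))).trans h13
    have h14' : s₁.reg 14 = z r := (hA 14 (by omega)).trans h14
    have hlt : i * n + c < (m + n) * n := index_lt hi hc
    have hTc := hT1 i hi c hc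
    have hzi := hz1 i hi
    have hv : s₁.arr 0 (i * n + c) = T i c := by
      simpa using hJT i hi c hc
    have hw : s₁.arr 1 i = z i := by
      simpa using hJz i hi
    have hf : |T i c * p| ≤ 1 := by
      rw [abs_mul]
      exact mul_le_one₀ hTc (abs_nonneg _) hp
    have hfz : |T i c * p * z r| ≤ Z := by
      rw [abs_mul]
      exact (mul_le_of_le_one_left (abs_nonneg _) hf).trans hzr
    have hd : |z i - T i c * p * z r| ≤ 2 * Z := (abs_sub _ _).trans (by omega)
    refine .mulNat (i * n) (by simp [hi', E'.r1]) (by omega) ?_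
    refine .addNat (i * n + c) (by simp [Mem.setReg, h13']) (by omega) ?_
    refine .load (i * n + c) (T i c) (by simp [Mem.setReg]) (by simp [Mem.setReg, hv])
      (by omega) ?_
    refine .mul (T i c * p) (by simp [Mem.setReg, h12']) (by omega) ?_
    refine .mul (T i c * p * z r) (by simp [Mem.setReg, h14']) (by omega) ?_
    refine .load i (z i) (by simp [Mem.setReg, hi']) (by simp [Mem.setReg, hw]) (by omega) ?_
    refine .sub (z i - T i c * p * z r) (by simp [Mem.setReg]) (by omega) ?_
    refine .store i (z i - T i c * p * z r) (by simp [Mem.setReg, hi']) (by simp [Mem.setReg])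
      (by omega) ?_
    refine (wp_updateRow (m := m) (n := n) (lam := lam) (i := i) (f := T i c * p) (V := V)
      (E'.of_agree (L := 15) ?_ (by omega)) (T := fun i' j' => if i' < i then
        T i' j' - V j' * (T i' c * p) else T i' j') ?_ ?_ hi ?_ hV1 hf ?_ ?_ hB).weaken le_rfl ?_
    · repeat first | exact Agree.refl _ _ | apply Agree.setArr | refine Agree.setReg ?_ (by omega)
    · simpa [Mem.setReg, Mem.setArr] using hJT
    · intro j hj
      simp [Mem.setReg, Mem.setArr, hJ0 5, hV j hj]
    · simpa using hT1 i hi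
    · simp [Mem.setReg, Mem.setArr]
    · simp [Mem.setReg, Mem.setArr]
    · rintro s' ⟨hA', hother, hmat⟩
      refine ⟨(?_ : Agree 15 s₁ _).trans (hA'.mono (by omega)), ?_, ?_, ?_, ?_⟩
      · repeat first
          | exact Agree.refl _ _ | apply Agree.setArr | refine Agree.setReg ?_ (by omega)
      · rw [hA' 20 (by omega)]
        simp [Mem.setReg, Mem.setArr, hi']
      · intro k hk hk1
        rw [hother k hk]
        simp [Mem.setReg, Mem.setArr, hk1, hJ0 k hk hk1]
      · refine hmat.congr fun i' _ j' _ => ?_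
        rcases lt_trichotomy i' i with h | rfl | h
        · simp [h, h.ne, h.trans (Nat.lt_succ_self i)]
        · simp
        · simp [h.not_gt, h.ne', show ¬ i' < i + 1 by omega]
      · rw [hother 1 (by omega)]
        simp only [Mem.setReg, Mem.setArr, Function.update_self]
        refine (hJz.update i _).congr fun i' _ => ?_
        rcases lt_trichotomy i' i with h | rfl | h
        · simp [h, h.ne, h.trans (Nat.lt_succ_self i)]
        · simp
        · simp [h.not_gt, h.ne', show ¬ i' < i + 1 by omega]
  · rintro s' hA ⟨h1, h2, h3⟩
    refine ⟨(hA₀.mono (by omega)).trans (hA.mono (by omega)), h1, h2.congr fun i hi j _ => ?_,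
      h3.congr fun i hi => ?_⟩ <;> simp [hi]

end RatRAM

/-! ### Subprograms for relaxation, consistency check and output. -/

namespace RatRAM

/-- Add to register 22 the inner product of the rows of the matrix in array 0 at the addresses given
by the registers 11 and 21. -/
def dotRows : Prog :=
  forTo 30 1 (.arith .add 31 11 30 ;; .load 32 0 31 ;; .arith .add 31 21 30 ;; .load 33 0 31 ;;
    .arith .mul 32 32 33 ;; .arith .add 22 22 32 ;; .skip)

theorem abs_sum_mul_le {n : ℕ} {u v : ℕ → ℤ} (hu : ∀ j < n, |u j| ≤ 1) (hv : ∀ j < n, |v j| ≤ 1)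
    {l : ℕ} (hl : l ≤ n) : |∑ k ∈ Finset.range l, u k * v k| ≤ l := by
  refine (Finset.abs_sum_le_sum_abs _ _).trans ?_
  have : ∀ k ∈ Finset.range l, |u k * v k| ≤ 1 := by
    intro k hk
    rw [Finset.mem_range] at hk
    rw [abs_mul]
    exact mul_le_one₀ (hu k (by omega)) (abs_nonneg _) (hv k (by omega))
  simpa using Finset.sum_le_card_nsmul _ _ _ this

theorem wp_dotRows {m n lam B i j : ℕ} {s : Mem} (E : Env m n lam s)
    {T : ℕ → ℕ → ℤ} (hT : IsMat (s.arr 0) (m + n) n T)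
    (hT1 : ∀ i < m + n, ∀ j < n, |T i j| ≤ 1) (hi : i < m + n) (hj : j < m + n)
    (h11 : s.reg 11 = (i * n : ℕ)) (h21 : s.reg 21 = (j * n : ℕ)) (h22 : s.reg 22 = 0)
    (hB : (m + n) * n + m + n + 1 ≤ B) :
    Wp dotRows (n * (6 + 2) + 2) B s fun s' => Agree 22 s s' ∧ s'.arr = s.arr ∧
      s'.reg 22 = (∑ k ∈ Finset.range n, T i k * T j k : ℤ) := by
  refine Wp.forTo (L := 22) (k := n) (fun l s' => s'.arr = s.arr ∧
    s'.reg 22 = (∑ k ∈ Finset.range l, T i k * T j k : ℤ))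
    (by omega) (by omega) (by omega) E.r4 E.r1 (by omega) ?_ ⟨rfl, by simpa using h22⟩ ?_
    fun _ hA h => ⟨hA, h⟩
  · intro l s' v h
    simpa [Mem.setReg] using h
  · intro l s₁ hl hA hl' hJ
    have h11' := (hA 11 (by omega)).trans h11
    have h21' := (hA 21 (by omega)).trans h21
    have hli : i * n + l < (m + n) * n := index_lt hi hl
    have hlj : j * n + l < (m + n) * n := index_lt hj hl
    have hTi := hT1 i hi l hl
    have hTj := hT1 j hj l hl
    have hTT : |T i l * T j l| ≤ 1 := by
      rw [abs_mul]
      exact mul_le_one₀ hTi (abs_nonneg _) hTj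
    have hsum := abs_sum_mul_le (hT1 i hi) (hT1 j hj) (show l + 1 ≤ n by omega)
    rw [Finset.sum_range_succ] at hsum
    refine .addNat (i * n + l) (by simp [h11', hl']) (by omega) ?_
    refine .load (i * n + l) (T i l) (by simp [Mem.setReg])
      (by simp [Mem.setReg, hJ.1, hT i hi l hl]) (by omega) ?_
    refine .addNat (j * n + l) (by simp [Mem.setReg, h21', hl']) (by omega) ?_
    refine .load (j * n + l) (T j l) (by simp [Mem.setReg])
      (by simp [Mem.setReg, hJ.1, hT j hj l hl]) (by omega) ?_
    refine .mul (T i l * T j l) (by simp [Mem.setReg]) (by omega) ?_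
    refine .add (∑ k ∈ Finset.range l, T i k * T j k + T i l * T j l)
      (by simp [Mem.setReg, hJ.2]) (by omega) ?_
    refine .skip ⟨?_, by simp [Mem.setReg, hl'], hJ.1, ?_⟩
    · repeat first | exact Agree.refl _ _ | apply Agree.setArr | refine Agree.setReg ?_ (by omega)
    · rw [Finset.sum_range_succ]
      simp [Mem.setReg]

/-- Put the Gram matrix of the last `n` rows of the matrix in array 0 into array 4. -/
def gram : Prog :=
  forTo 10 1 (.arith .add 11 0 10 ;; .arith .mul 11 11 1 ;; .arith .mul 12 10 1 ;;
    forTo 20 1 (.arith .add 21 0 20 ;; .arith .mul 21 21 1 ;; .const 22 0 ;; dotRows ;;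
      .arith .add 23 12 20 ;; .store 4 23 22 ;; .skip))

/-- Computed once in O(n³) steps, the Gram matrix reduces the update of X in a relaxation round from
O(n²) to O(n) steps. -/
theorem wp_gram {m n lam B : ℕ} {s : Mem} (E : Env m n lam s)
    {T : ℕ → ℕ → ℤ} (hT : IsMat (s.arr 0) (m + n) n T)
    (hT1 : ∀ i < m + n, ∀ j < n, |T i j| ≤ 1) (hB : (m + n) * n + m + n + 1 ≤ B) :
    Wp gram (n * ((n * ((2 + (n * (6 + 2) + 2) + 3) + 2) + 2 + 3) + 2) + 2) B s fun s' =>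
      Agree 10 s s' ∧ (∀ k, k ≠ 4 → s'.arr k = s.arr k) ∧
      IsMat (s'.arr 4) n n fun i j => ∑ k ∈ Finset.range n, T (m + i) k * T (m + j) k := by
  set G : ℕ → ℕ → ℤ := fun i j => ∑ k ∈ Finset.range n, T (m + i) k * T (m + j) k with hG
  refine Wp.forTo (L := 10) (k := n) (fun l s' => (∀ k, k ≠ 4 → s'.arr k = s.arr k) ∧
    IsMat (s'.arr 4) l n G)
    (by omega) (by omega) (by omega) E.r4 E.r1 (by omega) (fun _ _ _ h => h)
    ⟨fun _ _ => rfl, fun i hi => by omega⟩ ?_ fun _ hA h => ⟨hA, h⟩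
  intro i s₁ hi hA hi' hJ
  have E₁ := E.of_agree hA (by omega)
  have hin : (m + i) * n + i < (m + n) * n := index_lt (by omega) hi
  have hin' : i * n + i < (m + n) * n := index_lt (by omega) hi
  refine .addNat (m + i) (by simp [E₁.r0, hi']) (by omega) ?_
  refine .mulNat ((m + i) * n) (by simp [Mem.setReg, E₁.r1]) (by omega) ?_
  refine .mulNat (i * n) (by simp [Mem.setReg, hi', E₁.r1]) (by omega) ?_
  set s₂ : Mem := ((s₁.setReg 11 (m + i : ℕ)).setReg 11 ((m + i) * n : ℕ)).setReg 12 (i * n : ℕ)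
    with hs₂
  have hA₂ : Agree 11 s₁ s₂ := by
    repeat first | exact Agree.refl _ _ | apply Agree.setArr | refine Agree.setReg ?_ (by omega)
  have E₂ := E₁.of_agree hA₂ (by omega)
  have h11 : s₂.reg 11 = ((m + i) * n : ℕ) := by simp [hs₂, Mem.setReg]
  have h12 : s₂.reg 12 = (i * n : ℕ) := by simp [hs₂, Mem.setReg]
  refine Wp.forTo (L := 20) (k := n) (fun l s' => (∀ k, k ≠ 4 → s'.arr k = s.arr k) ∧
    IsMat (s'.arr 4) i n G ∧ ∀ j < l, s'.arr 4 (i * n + j) = G i j)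
    (by omega) (by omega) (by omega) E₂.r4 E₂.r1 (by omega) (fun _ _ _ h => h)
    ⟨hJ.1, hJ.2, by simp⟩ ?_ ?_
  · intro j s₃ hj hA₃ hj' hJ'
    have E₃ := E₂.of_agree hA₃ (by omega)
    have h11' := (hA₃ 11 (by omega)).trans h11
    have h12' := (hA₃ 12 (by omega)).trans h12
    have hjn : (m + j) * n + j < (m + n) * n := index_lt (by omega) hj
    have hijn : i * n + j < (m + n) * n := index_lt (by omega) hj
    have hGij : |G i j| ≤ n := abs_sum_mul_le (hT1 (m + i) (by omega)) (hT1 (m + j) (by omega)) le_rfl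
    refine .addNat (m + j) (by simp [E₃.r0, hj']) (by omega) ?_
    refine .mulNat ((m + j) * n) (by simp [Mem.setReg, E₃.r1]) (by omega) ?_
    refine .const 0 (by simp) ?_
    refine .seq (wp_dotRows (m := m) (lam := lam) (i := m + i) (j := m + j)
      (E₃.of_agree (L := 20) ?_ (by omega)) (T := T) ?_ hT1 (by omega) (by omega) ?_ ?_ ?_ hB) ?_
    · repeat first | exact Agree.refl _ _ | apply Agree.setArr | refine Agree.setReg ?_ (by omega)
    · simpa [Mem.setReg, hJ'.1 0] using hT
    · simpa [Mem.setReg] using h11'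
    · simp [Mem.setReg]
    · simp [Mem.setReg]
    · rintro s₄ ⟨hA₄, harr, h22⟩
      have h20 : s₄.reg 20 = j := by
        rw [hA₄ 20 (by omega)]
        simp [Mem.setReg, hj']
      have h12'' : s₄.reg 12 = (i * n : ℕ) := by
        rw [hA₄ 12 (by omega)]
        simpa [Mem.setReg] using h12'
      have harr' : s₄.arr = s₃.arr := harr
      refine .addNat (i * n + j) (by simp [h12'', h20]) (by omega) ?_
      refine .store (i * n + j) (G i j) (by simp [Mem.setReg]) (by simp [Mem.setReg, h22, hG])
        (by omega) ?_
      refine .skip ⟨(?_ : Agree 20 s₃ s₄).trans ?_, by simp [Mem.setReg, Mem.setArr, h20], ?_, ?_,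
        ?_⟩
      · refine Agree.trans ?_ (hA₄.mono (by omega))
        repeat first
          | exact Agree.refl _ _ | apply Agree.setArr | refine Agree.setReg ?_ (by omega)
      · repeat first
          | exact Agree.refl _ _ | apply Agree.setArr | refine Agree.setReg ?_ (by omega)
      · intro k hk
        simp [Mem.setReg, Mem.setArr, hk, harr', hJ'.1 k hk]
      · intro i' hi' j' hj'
        have : i' * n + j' ≠ i * n + j := fun h => hi'.ne (index_inj hj hj' h).1
        simp [Mem.setReg, Mem.setArr, this, harr', hJ'.2.1 i' hi' j' hj']
      · intro j' hj'
        rcases Nat.lt_succ_iff_lt_or_eq.1 hj' with h | rfl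
        · simp [Mem.setReg, Mem.setArr, h.ne, harr', hJ'.2.2 j' h]
        · simp [Mem.setReg, Mem.setArr]
  · rintro s' hA' ⟨h1, h2, h3⟩
    refine ⟨(hA₂.mono (by omega)).trans (hA'.mono (by omega)), ?_, h1, fun i' hi'' j' hj' => ?_⟩
    · rw [hA' 10 (by omega)]
      simp [hs₂, Mem.setReg, hi']
    · rcases Nat.lt_succ_iff_lt_or_eq.1 hi'' with h | rfl
      · exact h2 i' h j' hj'
      · exact h3 j' hj'

/-- Put the scaled starting point of the relaxation method into array 2. -/
def startPoint : Prog :=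
  forTo 10 1 (.arith .add 11 0 10 ;; .load 12 1 11 ;; .arith .sub 12 3 12 ;; .arith .mul 12 12 6 ;;
    .store 2 10 12 ;; .skip)

theorem wp_startPoint {m n lam B Z : ℕ} {s : Mem} (E : Env m n lam s)
    {z : ℕ → ℤ} (hz : IsVec (s.arr 1) (m + n) z) (hz1 : ∀ i < m + n, |z i| ≤ Z)
    (hB : (m + n) * n + m + n + 1 ≤ B) (hZB : Z ≤ B) (hZB' : Z * (2 * n ^ 2) ≤ B) :
    Wp startPoint (n * (5 + 2) + 2) B s fun s' =>
      Agree 10 s s' ∧ (∀ k, k ≠ 2 → s'.arr k = s.arr k) ∧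
      IsVec (s'.arr 2) n fun i => -z (m + i) * (2 * n ^ 2) := by
  refine Wp.forTo (L := 10) (k := n) (fun l s' => (∀ k, k ≠ 2 → s'.arr k = s.arr k) ∧
    IsVec (s'.arr 2) l fun i => -z (m + i) * (2 * n ^ 2))
    (by omega) (by omega) (by omega) E.r4 E.r1 (by omega) (fun _ _ _ h => h)
    ⟨fun _ _ => rfl, fun i hi => by omega⟩ ?_ fun _ hA h => ⟨hA, h⟩
  intro i s₁ hi hA hi' hJ
  have E₁ := E.of_agree hA (by omega)
  have hzi := hz1 (m + i) (by omega)
  have hD : |-z (m + i) * (2 * (n : ℤ) ^ 2)| ≤ (B : ℤ) := by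
    rw [abs_mul, abs_neg, abs_of_nonneg (by positivity : (0 : ℤ) ≤ 2 * (n : ℤ) ^ 2)]
    refine (mul_le_mul_of_nonneg_right hzi (by positivity)).trans ?_
    exact_mod_cast hZB'
  refine .addNat (m + i) (by simp [E₁.r0, hi']) (by omega) ?_
  refine .load (m + i) (z (m + i)) (by simp [Mem.setReg])
    (by simp [Mem.setReg, hJ.1 1, hz (m + i) (by omega)]) (by omega) ?_
  refine .sub (-z (m + i)) (by simp [Mem.setReg, E₁.r3]) (by rw [abs_neg]; omega) ?_
  refine .mul (-z (m + i) * (2 * n ^ 2)) (by simp [Mem.setReg, E₁.r6]) hD ?_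
  refine .store i (-z (m + i) * (2 * n ^ 2)) (by simp [Mem.setReg, hi']) (by simp [Mem.setReg])
    hD ?_
  refine .skip ⟨?_, by simp [Mem.setReg, Mem.setArr, hi'], ?_, ?_⟩
  · repeat first | exact Agree.refl _ _ | apply Agree.setArr | refine Agree.setReg ?_ (by omega)
  · intro k hk
    simp [Mem.setReg, Mem.setArr, hk, hJ.1 k hk]
  · intro i' hi''
    rcases Nat.lt_succ_iff_lt_or_eq.1 hi'' with h | rfl
    · simpa [Mem.setReg, Mem.setArr, h.ne] using hJ.2 i' h
    · simp [Mem.setReg, Mem.setArr]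

/-- Look for a coordinate of array 2 that violates its bounds: put it into register 12 and the
direction of the correction into register 11. -/
def findViolated : Prog :=
  .const 11 0 ;; .const 12 0 ;;
  forTo 20 1 (.load 21 2 20 ;;
    .ifLt 21 3 (.const 11 1 ;; .arith .add 12 20 3 ;; .skip)
      (.ifLt 7 21 (.const 11 (-1) ;; .arith .add 12 20 3 ;; .skip) .skip))

/-- The index `v` and the sign `σ` describe a violation of the bounds `0` and `U` by `X`, or
`σ = 0` and there is none. -/
def IsViolation (X : ℕ → ℤ) (n U : ℕ) (σ : ℤ) (v : ℕ) : Prop :=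
  (σ = 0 ∧ ∀ i < n, 0 ≤ X i ∧ X i ≤ U) ∨ (σ = 1 ∧ X v < 0) ∨ (σ = -1 ∧ U < X v)

/-- Any violated coordinate serves the potential argument; the scan keeps the last one. The bound `v
< n` is kept even if σ = 0, so that the correction always reads an existing row. -/
theorem wp_findViolated {m n lam B : ℕ} {s : Mem} (E : Env m n lam s) (hn : 0 < n)
    {X : ℕ → ℤ} (hX : IsVec (s.arr 2) n X) (hX1 : ∀ i < n, |X i| ≤ B) (hB : n + 1 ≤ B) :
    Wp findViolated (n * ((2 + 1 + 1 + 1) + 2) + 2 + 2) B s fun s' => Agree 11 s s' ∧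
      s'.arr = s.arr ∧ ∃ (σ : ℤ) (v : ℕ), s'.reg 11 = σ ∧ s'.reg 12 = v ∧ v < n ∧
        IsViolation X n (2 * n ^ 2 * lam) σ v := by
  refine .const 0 (by simp) ?_
  refine .const 0 (by simp) ?_
  set s₀ : Mem := (s.setReg 11 (0 : ℤ)).setReg 12 (0 : ℤ) with hs₀
  have hA₀ : Agree 11 s s₀ := by
    repeat first | exact Agree.refl _ _ | apply Agree.setArr | refine Agree.setReg ?_ (by omega)
  have E₀ := E.of_agree hA₀ (by omega)
  refine Wp.forTo (L := 11) (k := n) (fun l s' => s'.arr = s.arr ∧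
    ∃ (σ : ℤ) (v : ℕ), s'.reg 11 = σ ∧ s'.reg 12 = v ∧ v < n ∧
        IsViolation X l (2 * n ^ 2 * lam) σ v)
    (by omega) (by omega) (by omega) E₀.r4 E₀.r1 (by omega) ?_ ?_ ?_
    fun _ hA h => ⟨hA₀.trans hA, h⟩
  · intro l s' v h
    simpa [Mem.setReg] using h
  · exact ⟨rfl, 0, 0, by simp [hs₀, Mem.setReg], by simp [hs₀, Mem.setReg], hn,
      Or.inl ⟨rfl, by simp⟩⟩
  · intro i s₁ hi hA hi' hJ
    have E₁ := E₀.of_agree hA (by omega)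
    have h7 : s₁.reg 7 = ((2 * n ^ 2 * lam : ℕ) : ℤ) := by rw [E₁.r7, Int.cast_natCast]
    refine .load i (X i) hi' (by rw [hJ.1, hX i hi]) (hX1 i hi) ?_
    refine .ite ?_ fun hlt => .ite ?_ ?_
    · intro hlt
      have hneg : X i < 0 := by
        have : (X i : ℚ) < 0 := by simpa [Mem.setReg, E₁.r3] using hlt
        exact_mod_cast this
      refine .const 1 (by simp; omega) ?_
      refine .addNat i (by simp [Mem.setReg, hi', E₁.r3]) (by omega) ?_
      refine .skip ⟨?_, by simp [Mem.setReg, hi'], hJ.1, 1, i, by simp [Mem.setReg],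
        by simp [Mem.setReg], hi, Or.inr (Or.inl ⟨rfl, hneg⟩)⟩
      repeat first | exact Agree.refl _ _ | apply Agree.setArr | refine Agree.setReg ?_ (by omega)
    · intro hlt'
      have hbig : ((2 * n ^ 2 * lam : ℕ) : ℤ) < X i := by
        have : (((2 * n ^ 2 * lam : ℕ) : ℤ) : ℚ) < (X i : ℚ) := by
          simpa only [Mem.setReg, Function.update_self, Function.update_of_ne (show 7 ≠ 21 by omega),
            h7] using hlt'
        exact_mod_cast this
      refine .const (-1) (by simp; omega) ?_
      refine .addNat i (by simp [Mem.setReg, hi', E₁.r3]) (by omega) ?_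
      refine .skip ⟨?_, by simp [Mem.setReg, hi'], hJ.1, -1, i, by simp [Mem.setReg],
        by simp [Mem.setReg], hi, Or.inr (Or.inr ⟨rfl, hbig⟩)⟩
      repeat first | exact Agree.refl _ _ | apply Agree.setArr | refine Agree.setReg ?_ (by omega)
    · intro hlt'
      have h1 : 0 ≤ X i := by
        have : ¬ (X i : ℚ) < 0 := by simpa [Mem.setReg, E₁.r3] using hlt
        exact_mod_cast not_lt.1 this
      have h2 : X i ≤ ((2 * n ^ 2 * lam : ℕ) : ℤ) := by
        have : ¬ (((2 * n ^ 2 * lam : ℕ) : ℤ) : ℚ) < (X i : ℚ) := by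
          simpa only [Mem.setReg, Function.update_self, Function.update_of_ne (show 7 ≠ 21 by omega),
            h7] using hlt'
        exact_mod_cast not_lt.1 this
      obtain ⟨σ, v, hσ, hv, hvn, hvio⟩ := hJ.2
      refine .skip ⟨?_, by simp [Mem.setReg, hi'], hJ.1, σ, v, by simp [Mem.setReg, hσ],
        by simp [Mem.setReg, hv], hvn, ?_⟩
      · repeat first
          | exact Agree.refl _ _ | apply Agree.setArr | refine Agree.setReg ?_ (by omega)
      · refine hvio.imp_left fun h => ⟨h.1, fun i' hi'' => ?_⟩
        rcases Nat.lt_succ_iff_lt_or_eq.1 hi'' with h' | rfl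
        · exact h.2 i' h'
        · exact ⟨h1, h2⟩

/-- Add a row of the Gram matrix to array 2, as determined by `findViolated`. -/
def correct : Prog :=
  .arith .mul 13 12 1 ;;
  forTo 20 1 (.arith .add 21 13 20 ;; .load 22 4 21 ;; .arith .mul 22 22 11 ;; .load 23 2 20 ;;
    .arith .add 23 23 22 ;; .store 2 20 23 ;; .skip)

/-- The case σ = 0 is included and leaves X unchanged, so the main loop does not branch on
feasibility. -/
theorem wp_correct {m n lam B Z v : ℕ} {s : Mem} (E : Env m n lam s)
    {X : ℕ → ℤ} (hX : IsVec (s.arr 2) n X) {G : ℕ → ℕ → ℤ} (hG : IsMat (s.arr 4) n n G)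
    {σ : ℤ} (hX1 : ∀ i < n, |X i| ≤ Z) (hG1 : ∀ i < n, ∀ j < n, |G i j| ≤ n) (hσ : |σ| ≤ 1)
    (h11 : s.reg 11 = σ) (h12 : s.reg 12 = v) (hv : v < n)
    (hB : (m + n) * n + m + n + 1 ≤ B) (hZB : Z + n ≤ B) :
    Wp correct (n * (6 + 2) + 2 + 1) B s fun s' => Agree 11 s s' ∧
      (∀ k, k ≠ 2 → s'.arr k = s.arr k) ∧ IsVec (s'.arr 2) n fun i => X i + G v i * σ := by
  have hvn : v * n + v < (m + n) * n := index_lt (by omega) hv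
  refine .mulNat (v * n) (by simp [h12, E.r1]) (by omega) ?_
  set s₀ : Mem := s.setReg 13 (v * n : ℕ) with hs₀
  have hA₀ : Agree 13 s s₀ := by
    repeat first | exact Agree.refl _ _ | apply Agree.setArr | refine Agree.setReg ?_ (by omega)
  have E₀ := E.of_agree hA₀ (by omega)
  have h11₀ : s₀.reg 11 = σ := by simp [hs₀, Mem.setReg, h11]
  have h13₀ : s₀.reg 13 = (v * n : ℕ) := by simp [hs₀, Mem.setReg]
  refine Wp.forTo (L := 14) (k := n) (fun l s' => (∀ k, k ≠ 2 → s'.arr k = s.arr k) ∧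
    IsVec (s'.arr 2) n fun i => if i < l then X i + G v i * σ else X i)
    (by omega) (by omega) (by omega) E₀.r4 E₀.r1 (by omega) (fun _ _ _ h => h)
    ⟨fun _ _ => rfl, hX.congr (by simp)⟩ ?_ ?_
  · intro i s₁ hi hA hi' hJ
    have h11₁ := (hA 11 (by omega)).trans h11₀
    have h13₁ := (hA 13 (by omega)).trans h13₀
    have hlt : v * n + i < (m + n) * n := index_lt (by omega) hi
    have hGi := hG1 v hv i hi
    have hXi := hX1 i hi
    have hGσ : |G v i * σ| ≤ n := by
      rw [abs_mul]
      exact (mul_le_of_le_one_right (abs_nonneg _) hσ).trans hGi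
    have hsum : |X i + G v i * σ| ≤ Z + n := (abs_add_le _ _).trans (by omega)
    have hXv : s₁.arr 2 i = X i := by simpa using hJ.2 i hi
    refine .addNat (v * n + i) (by simp [h13₁, hi']) (by omega) ?_
    refine .load (v * n + i) (G v i) (by simp [Mem.setReg])
      (by simp [Mem.setReg, hJ.1 4, hG v hv i hi]) (by omega) ?_
    refine .mul (G v i * σ) (by simp [Mem.setReg, h11₁]) (by omega) ?_
    refine .load i (X i) (by simp [Mem.setReg, hi']) (by simp [Mem.setReg, hXv]) (by omega) ?_
    refine .add (X i + G v i * σ) (by simp [Mem.setReg]) (by omega) ?_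
    refine .store i (X i + G v i * σ) (by simp [Mem.setReg, hi']) (by simp [Mem.setReg])
      (by omega) ?_
    refine .skip ⟨?_, by simp [Mem.setReg, Mem.setArr, hi'], ?_, ?_⟩
    · repeat first | exact Agree.refl _ _ | apply Agree.setArr | refine Agree.setReg ?_ (by omega)
    · intro k hk
      simp [Mem.setReg, Mem.setArr, hk, hJ.1 k hk]
    · simp only [Mem.setReg, Mem.setArr, Function.update_self]
      refine (hJ.2.update i _).congr fun i' _ => ?_
      rcases lt_trichotomy i' i with h | rfl | h
      · simp [h, h.ne, h.trans (Nat.lt_succ_self i)]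
      · simp
      · simp [h.not_gt, h.ne', show ¬ i' < i + 1 by omega]
  · rintro s' hA ⟨h1, h2⟩
    refine ⟨(hA₀.mono (by omega)).trans (hA.mono (by omega)), h1, h2.congr fun i hi => ?_⟩
    simp [hi]

/-- Set register 11 to one if one of the first `m` cells of array 1 is not zero. -/
def checkResidual : Prog :=
  forTo 20 0 (.load 21 1 20 ;; .arith .mul 22 21 21 ;; .ifLt 3 22 (.const 11 1 ;; .skip) .skip)

/-- Register 11 enters with the violation sign and is only overwritten by 1; it leaves as a joint
flag for violated bounds and inconsistent equations. -/
theorem wp_checkResidual {m n lam B Z : ℕ} {s : Mem} (E : Env m n lam s)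
    {z : ℕ → ℤ} (hz : IsVec (s.arr 1) (m + n) z) (hz1 : ∀ i < m + n, |z i| ≤ Z)
    {σ : ℤ} (h11 : s.reg 11 = σ) (hmB : m + 1 ≤ B) (hZB : Z ≤ B) (hZB' : Z * Z ≤ B) :
    Wp checkResidual (m * ((1 + 1 + 2) + 2) + 2) B s fun s' => Agree 11 s s' ∧
      s'.arr = s.arr ∧ ((s'.reg 11 = σ ∧ ∀ i < m, z i = 0) ∨ (s'.reg 11 = 1 ∧ ∃ i < m, z i ≠ 0)) := by
  refine Wp.forTo (L := 11) (k := m) (fun l s' => s'.arr = s.arr ∧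
    ((s'.reg 11 = σ ∧ ∀ i < l, z i = 0) ∨ (s'.reg 11 = 1 ∧ ∃ i < m, z i ≠ 0)))
    (by omega) (by omega) (by omega) E.r4 E.r0 (by omega) ?_ ⟨rfl, Or.inl ⟨h11, by simp⟩⟩ ?_
    fun _ hA h => ⟨hA, h⟩
  · intro l s' v h
    simpa [Mem.setReg] using h
  · intro i s₁ hi hA hi' hJ
    have E₁ := E.of_agree hA (by omega)
    have hzi := hz1 i (by omega)
    have hzz : |z i * z i| ≤ B := by
      rw [abs_mul]
      refine (mul_le_mul hzi hzi (abs_nonneg _) (by positivity)).trans ?_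
      exact_mod_cast hZB'
    refine .load i (z i) hi' (by rw [hJ.1, hz i (by omega)]) (by omega) ?_
    refine .mul (z i * z i) (by simp [Mem.setReg]) hzz ?_
    refine .ite ?_ ?_
    · intro hlt
      have hne : z i ≠ 0 := by
        intro h
        simp [Mem.setReg, E₁.r3, h] at hlt
      refine .const 1 (by simp; omega) ?_
      refine .skip ⟨?_, by simp [Mem.setReg, hi'], hJ.1, Or.inr ⟨by simp [Mem.setReg], i, hi, hne⟩⟩
      repeat first | exact Agree.refl _ _ | apply Agree.setArr | refine Agree.setReg ?_ (by omega)
    · intro hlt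
      have h0 : z i = 0 := by simpa [Mem.setReg, E₁.r3] using hlt
      refine .skip ⟨?_, by simp [Mem.setReg, hi'], hJ.1, ?_⟩
      · repeat first
          | exact Agree.refl _ _ | apply Agree.setArr | refine Agree.setReg ?_ (by omega)
      · rcases hJ.2 with ⟨h1, h2⟩ | ⟨h1, h2⟩
        · refine Or.inl ⟨by simpa [Mem.setReg] using h1, fun i' hi'' => ?_⟩
          rcases Nat.lt_succ_iff_lt_or_eq.1 hi'' with h | rfl
          · exact h2 i' h
          · exact h0
        · exact Or.inr ⟨by simpa [Mem.setReg] using h1, h2⟩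

/-- Undo the scaling of array 2 and report success. -/
def output : Prog :=
  forTo 20 1 (.load 21 2 20 ;; .arith .div 21 21 6 ;; .store 2 20 21 ;; .skip) ;; .const 0 1 ;; .skip

theorem wp_output {m n lam B : ℕ} {s : Mem} (E : Env m n lam s) (hn : 0 < n)
    {X : ℕ → ℤ} (hX : IsVec (s.arr 2) n X) (hX1 : ∀ i < n, |X i| ≤ B) (hB : n + 1 ≤ B)
    (hDB : 2 * n ^ 2 ≤ B) :
    Wp output (1 + (n * (3 + 2) + 2)) B s fun s' => s'.reg 0 = 1 ∧
      ∀ i < n, s'.arr 2 i = (X i : ℚ) / (2 * n ^ 2 : ℕ) := by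
  refine .seq (Q' := fun s' => ∀ i < n, s'.arr 2 i = (X i : ℚ) / (2 * n ^ 2 : ℕ))
    (Wp.forTo (L := 10) (k := n)
      (fun l s' => ∀ i < n, s'.arr 2 i = if i < l then (X i : ℚ) / (2 * n ^ 2 : ℕ) else X i)
    (by omega) (by omega) (by omega) E.r4 E.r1 (by omega) (fun _ _ _ h => h)
    ?_ ?_ ?_) ?_
  · intro i hi
    simpa using hX i hi
  · intro i s₁ hi hA hi' hJ
    have E₁ := E.of_agree hA (by omega)
    have hXi : s₁.arr 2 i = X i := by simpa using hJ i hi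
    have hD : 0 < 2 * n ^ 2 := by positivity
    refine .load i (X i) hi' hXi (hX1 i hi) ?_
    refine .div (X i) (2 * n ^ 2) (by simp [Mem.setReg]) (by simp [Mem.setReg, E₁.r6]) (hX1 i hi) hD
      hDB ?_
    refine .storeQuot i (X i) (2 * n ^ 2) (by simp [Mem.setReg, hi']) (by simp [Mem.setReg])
      (hX1 i hi) hD hDB ?_
    refine .skip ⟨?_, by simp [Mem.setReg, Mem.setArr, hi'], ?_⟩
    · repeat first | exact Agree.refl _ _ | apply Agree.setArr | refine Agree.setReg ?_ (by omega)
    · intro i' hi''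
      have := hJ i' hi''
      simp only [Mem.setReg, Mem.setArr, Function.update_self]
      rcases lt_trichotomy i' i with h | rfl | h
      · simpa [h, h.ne, h.trans (Nat.lt_succ_self i)] using this
      · simp
      · simpa [h.not_gt, h.ne', show ¬ i' < i + 1 by omega] using this
  · intro s' _ h i hi
    simpa [hi] using h i hi
  · intro s' h
    refine .const 1 (by simp; omega) ?_
    exact .skip ⟨by simp [Mem.setReg], h⟩

end RatRAM

/-! ### Correspondence between array contents and the elimination state. -/

section Encoding

open Matrix

variable {m n : ℕ}

/-- The functions `T` and `z` list the data of a state of the elimination, in the order in which they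
are stored by the program. -/
structure Encodes (A : Matrix (Fin m) (Fin n) ℤ) (b : Fin m → ℤ) (M : Matrix (Fin n) (Fin n) ℤ)
    (x₀ : Fin n → ℤ) (T : ℕ → ℕ → ℤ) (z : ℕ → ℤ) : Prop where
  top : ∀ (i : Fin m) (j : Fin n), T i j = (A * M) i j
  bot : ∀ k j : Fin n, T (m + k) j = M k j
  ztop : ∀ i : Fin m, z i = b i - A.mulVec x₀ i
  zbot : ∀ k : Fin n, z (m + k) = -x₀ k

variable {A : Matrix (Fin m) (Fin n) ℤ} {b : Fin m → ℤ} {M : Matrix (Fin n) (Fin n) ℤ}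
  {x₀ : Fin n → ℤ} {T : ℕ → ℕ → ℤ} {z : ℕ → ℤ}

theorem abs_signType_cast_le (σ : SignType) : |(σ : ℤ)| ≤ 1 := by cases σ <;> simp

theorem ElimInv.abs_le {S : Set (Fin m)} (h : ElimInv A b S M x₀) (k j : Fin n) : |M k j| ≤ 1 := by
  obtain ⟨σ, hσ⟩ := h.tu.apply (Sum.inr k) j
  rw [fromRows_apply_inr] at hσ
  exact hσ ▸ abs_signType_cast_le σ

theorem Encodes.abs_le (hT : Encodes A b M x₀ T z) {S : Set (Fin m)} (h : ElimInv A b S M x₀) :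
    ∀ i < m + n, ∀ j < n, |T i j| ≤ 1 := by
  intro i hi j hj
  by_cases him : i < m
  · obtain ⟨σ, hσ⟩ := h.tu.apply (Sum.inl ⟨i, him⟩) ⟨j, hj⟩
    rw [fromRows_apply_inl, ← hT.top] at hσ
    exact hσ ▸ abs_signType_cast_le σ
  · have := hT.bot ⟨i - m, by omega⟩ ⟨j, hj⟩
    simp only [show m + (i - m) = i by omega] at this
    exact this ▸ h.abs_le _ _

/-- With the sign in `-x₀`, the vector (b - A x₀, -x₀) transforms like an additional column of the
stacked matrix (A M, M), so a single row operation updates both. -/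
theorem Encodes.pivot (hT : Encodes A b M x₀ T z) (r : Fin m) (c : Fin n) :
    Encodes A b (pivotMat A M r c) (pivotVec A b M x₀ r c)
      (fun i j => T i j - T r j * (T i c * T r c)) (fun i => z i - T i c * T r c * z r) where
  top i j := by
    rw [mul_pivotMat, hT.top, hT.top, hT.top, hT.top]
    ring
  bot k j := by
    rw [hT.bot, hT.bot, hT.top, hT.top]
    simp only [pivotMat, Matrix.of_apply]
    ring
  ztop i := by
    rw [mulVec_pivotVec, hT.top, hT.top, hT.ztop, hT.ztop]
    ring
  zbot k := by
    rw [hT.bot, hT.top, hT.ztop, hT.zbot]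
    simp only [pivotVec]
    ring

/-- Applying A to x = x₀ + M x and using A M = 0 gives A x₀ = A x = b. Thus a non-zero residual
certifies inconsistency. -/
theorem ElimInv.residual_eq_zero (h : ElimInv A b Set.univ M x₀) {x : Fin n → ℝ}
    (hx : (A.map (Int.cast : ℤ → ℝ)).mulVec x = (fun i => (b i : ℝ))) (i : Fin m) :
    b i - A.mulVec x₀ i = 0 := by
  have hk := h.sol x hx
  have hi := congrFun hx i
  have : (b i : ℝ) - (A.mulVec x₀ i : ℤ) = 0 := by
    have hAM : ∑ k, ∑ j, (A i k : ℝ) * (M k j * x j) = 0 := by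
      rw [Finset.sum_comm]
      refine Finset.sum_eq_zero fun j _ => ?_
      have hz : ((∑ k, A i k * M k j : ℤ) : ℝ) = 0 := by
        rw [← Matrix.mul_apply, h.zero i trivial j, Int.cast_zero]
      push_cast at hz
      simp only [← mul_assoc, ← Finset.sum_mul, hz, zero_mul]
    rw [← hi]
    simp only [Matrix.mulVec, dotProduct, Matrix.map_apply]
    rw [Finset.sum_congr rfl fun k _ => congrArg ((A i k : ℝ) * ·) (hk k)]
    simp only [mul_add, Finset.sum_add_distrib, Finset.mul_sum, hAM]
    push_cast
    ring
  exact_mod_cast this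

/-- Since A M = 0, the parameter Y drops out and A X = D A x₀ = D b. -/
theorem ElimInv.mulVec_eq (h : ElimInv A b Set.univ M x₀) (hres : ∀ i, b i - A.mulVec x₀ i = 0)
    {X Y : Fin n → ℤ} {D : ℤ} (hD : D ≠ 0) (hX : ∀ k, X k = D * x₀ k + ∑ j, M k j * Y j) :
    (A.map (Int.cast : ℤ → ℝ)).mulVec (fun k => (X k : ℝ) / D) = (fun i => (b i : ℝ)) := by
  funext i
  have hAM : ∑ k, ∑ j, A i k * (M k j * Y j) = 0 := by
    rw [Finset.sum_comm]
    refine Finset.sum_eq_zero fun j _ => ?_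
    simp only [← mul_assoc, ← Finset.sum_mul]
    rw [← Matrix.mul_apply, h.zero i trivial j, zero_mul]
  have hAX : ∑ k, A i k * X k = D * b i := by
    have h1 : b i = ∑ k, A i k * x₀ k := by simpa [Matrix.mulVec, dotProduct] using sub_eq_zero.1 (hres i)
    rw [h1, Finset.mul_sum]
    simp only [hX, mul_add, Finset.sum_add_distrib, Finset.mul_sum, hAM, add_zero]
    exact Finset.sum_congr rfl fun k _ => by ring
  have hD' : (D : ℝ) ≠ 0 := by exact_mod_cast hD
  simp only [Matrix.mulVec, dotProduct, Matrix.map_apply, ← mul_div_assoc]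
  rw [← Finset.sum_div, div_eq_iff hD', mul_comm (b i : ℝ)]
  exact_mod_cast hAX

end Encoding

/-! ### The two main loops and the complete program. -/

namespace RatRAM

/-- All the numbers that occur in a run of the algorithm are at most `B` in absolute value, provided
that the candidate solutions and residuals are bounded by `Z`. -/
structure Fits (m n lam Z B : ℕ) : Prop where
  index : (m + n) * n + m + n + 1 ≤ B
  scale : 2 * n ^ 2 ≤ B
  bound : 2 * n ^ 2 * lam ≤ B
  rounds : 4 * n ^ 4 * lam ^ 2 ≤ B
  vec : 2 * Z ≤ B
  vec_sq : Z * Z ≤ B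
  point : Z * (2 * n ^ 2) + 4 * n ^ 4 * lam ^ 2 * n ≤ B

/-- Gaussian elimination. -/
def eliminateAll : Prog := forTo 10 0 (findPivot ;; eliminate)

/-- The matrix and the vector in the arrays 0 and 1 describe a state of the elimination. -/
def ElimState {m n : ℕ} (A : Matrix (Fin m) (Fin n) ℤ) (b : Fin m → ℤ) (R : Set (Fin m))
    (M : Matrix (Fin n) (Fin n) ℤ) (x₀ : Fin n → ℤ) (T : ℕ → ℕ → ℤ) (z : ℕ → ℤ) (Z : ℕ) (s : Mem) :
    Prop :=
  IsMat (s.arr 0) (m + n) n T ∧ IsVec (s.arr 1) (m + n) z ∧ ElimInv A b R M x₀ ∧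
    Encodes A b M x₀ T z ∧ ∀ i < m + n, |z i| ≤ Z

/-- Total unimodularity keeps all matrix entries at most 1 in absolute value, so only the vector can
grow. A pivot at most doubles it, and the factor `2 ^ m` costs no more than m additional bits. -/
theorem wp_eliminateAll {m n lam B Z : ℕ} {s : Mem} (E : Env m n lam s) (hn : 0 < n)
    {A : Matrix (Fin m) (Fin n) ℤ} {b : Fin m → ℤ}
    (h : ∃ M x₀ T z, ElimState A b ∅ M x₀ T z Z s) (hB : Fits m n lam (2 ^ m * Z) B) :
    Wp eliminateAll (m * (((m + n) * ((n * (6 + 2) + 2 + 8) + 2) + 2 + 1 +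
        (n * (7 + 2) + 2 + 3)) + 2) + 2) B s fun s' => Agree 10 s s' ∧
      (∀ k, k ≠ 0 → k ≠ 1 → k ≠ 5 → s'.arr k = s.arr k) ∧
      ∃ M x₀ T z, ElimState A b Set.univ M x₀ T z (2 ^ m * Z) s' := by
  refine Wp.forTo (L := 10) (k := m)
    (fun r s' => (∀ k, k ≠ 0 → k ≠ 1 → k ≠ 5 → s'.arr k = s.arr k) ∧
      ∃ M x₀ T z, ElimState A b {i | i.val < r} M x₀ T z (2 ^ r * Z) s')
    (by omega) (by omega) (by omega) E.r4 E.r0 (by have := hB.index; omega) (fun _ _ _ h => h)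
    ⟨fun _ _ _ _ => rfl, by simpa using h⟩ ?_ ?_
  · rintro r s₁ hr hA h10 ⟨hother, M, x₀, T, z, hT, hz, hE, hC, hzZ⟩
    have E₁ := E.of_agree hA le_rfl
    have hT1 := hC.abs_le hE
    have hZB : 2 * (2 ^ r * Z) ≤ B := by
      have : 2 ^ r * Z ≤ 2 ^ m * Z := Nat.mul_le_mul_right _ (Nat.pow_le_pow_right (by omega) hr.le)
      have := hB.vec
      omega
    refine .seq (wp_findPivot E₁ hn hT hT1 hr h10 hB.index) ?_
    rintro s₂ ⟨hA₂, hother₂, h5, c, hc, h12, h13, hpiv⟩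
    have h0₂ : s₂.arr 0 = s₁.arr 0 := hother₂ 0 (by omega)
    have h1₂ : s₂.arr 1 = s₁.arr 1 := hother₂ 1 (by omega)
    refine (wp_eliminate (E₁.of_agree hA₂ (by omega)) (h0₂ ▸ hT) h5 (h1₂ ▸ hz) hT1
      (hT1 r (by omega)) (hT1 r (by omega) c hc) hzZ hr hc ((hA₂ 10 (by omega)).trans h10) h12 h13
      hB.index hZB).weaken le_rfl ?_
    rintro s₃ ⟨hA₃, hother₃, hT₃, hz₃⟩
    refine ⟨(hA₂.mono (by omega)).trans (hA₃.mono (by omega)), ?_, ?_, ?_⟩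
    · rw [hA₃ 10 (by omega), hA₂ 10 (by omega), h10]
    · intro k hk0 hk1 hk5
      rw [hother₃ k hk0 hk1, hother₂ k hk5, hother k hk0 hk1 hk5]
    · refine ⟨_, _, _, _, hT₃, hz₃, ?_, hC.pivot ⟨r, hr⟩ ⟨c, hc⟩, ?_⟩
      · have := hE.pivot ⟨r, hr⟩ ⟨c, hc⟩ (fun h0 j => by
          rw [← hC.top] at h0 ⊢
          exact hpiv h0 j j.2)
        convert this using 1
        ext i
        simp only [Set.mem_ofPred_eq, Set.mem_insert_iff, Fin.ext_iff]
        omega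
      · intro i hi
        have h1 : |T i c * T r c * z r| ≤ 1 * (2 ^ r * Z : ℕ) := by
          rw [abs_mul, abs_mul]
          exact mul_le_mul (mul_le_one₀ (hT1 i hi c hc) (abs_nonneg _) (hT1 r (by omega) c hc))
            (hzZ r (by omega)) (abs_nonneg _) (by omega)
        have h2 := hzZ i hi
        refine (abs_sub _ _).trans ((add_le_add h2 h1).trans (le_of_eq ?_))
        push_cast
        ring
  · rintro s' hA ⟨h1, M, x₀, T, z, h2⟩
    have : {i : Fin m | i.val < m} = Set.univ := Set.eq_univ_of_forall fun i => i.2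
    rw [this] at h2
    exact ⟨hA, h1, M, x₀, T, z, h2⟩

/-- The relaxation method. -/
def relax : Prog := forTo 10 8 (findViolated ;; correct)

/-- Gram entries are at most n, so X moves by at most n per coordinate and round. This linear drift
bounds the numbers throughout. -/
theorem wp_relax {m n lam B Z : ℕ} {s : Mem} (E : Env m n lam s) (hn : 0 < n)
    {M : Matrix (Fin n) (Fin n) ℤ} (hM : ∀ i j, |M i j| ≤ 1) {x₀ : Fin n → ℤ}
    {G : ℕ → ℕ → ℤ} (hG : IsMat (s.arr 4) n n G) (hG1 : ∀ i < n, ∀ j < n, |G i j| ≤ n)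
    (hGM : ∀ i j : Fin n, G i j = ∑ k, M i k * M j k)
    {X : ℕ → ℤ} (hX : IsVec (s.arr 2) n X) (hX1 : ∀ i < n, |X i| ≤ (Z * (2 * n ^ 2) : ℕ))
    (hR : RelaxInv M x₀ lam 0 fun k => X k) (hB : Fits m n lam Z B) :
    Wp relax (4 * n ^ 4 * lam ^ 2 *
        ((n * (6 + 2) + 2 + 1 + (n * ((2 + 1 + 1 + 1) + 2) + 2 + 2)) + 2) + 2) B s fun s' =>
      Agree 10 s s' ∧ (∀ k, k ≠ 2 → s'.arr k = s.arr k) ∧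
      ∃ X : ℕ → ℤ, IsVec (s'.arr 2) n X ∧ (∀ i < n, |X i| ≤ B) ∧
        RelaxInv M x₀ lam (4 * n ^ 4 * lam ^ 2) fun k => X k := by
  refine Wp.forTo (L := 10) (k := 4 * n ^ 4 * lam ^ 2)
    (fun t s' => (∀ k, k ≠ 2 → s'.arr k = s.arr k) ∧
      ∃ X : ℕ → ℤ, IsVec (s'.arr 2) n X ∧ (∀ i < n, |X i| ≤ (Z * (2 * n ^ 2) + t * n : ℕ)) ∧
        RelaxInv M x₀ lam t fun k => X k)
    (by omega) (by omega) (by omega) E.r4 E.r8 hB.rounds (fun _ _ _ h => h)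
    ⟨fun _ _ => rfl, X, hX, by simpa using hX1, hR⟩ ?_ ?_
  · rintro t s₁ ht hA h10 ⟨hother, X, hX, hX1, hR⟩
    have E₁ := E.of_agree hA le_rfl
    have hZB : Z * (2 * n ^ 2) + t * n + n ≤ B := by
      have : (t + 1) * n ≤ 4 * n ^ 4 * lam ^ 2 * n := Nat.mul_le_mul_right _ ht
      have := hB.point
      rw [add_mul] at *
      omega
    have hX2 : ∀ i < n, |X i| ≤ B := fun i hi => (hX1 i hi).trans (by exact_mod_cast (by omega))
    refine .seq (wp_findViolated E₁ hn hX hX2 (by have := hB.index; omega)) ?_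
    rintro s₂ ⟨hA₂, harr, σ, v, hσ, hv, hvn, hvio⟩
    have hσ1 : |σ| ≤ 1 := by
      rcases hvio with ⟨rfl, _⟩ | ⟨rfl, _⟩ | ⟨rfl, _⟩ <;> simp
    refine (wp_correct (m := m) (Z := Z * (2 * n ^ 2) + t * n) (E₁.of_agree hA₂ (by omega))
      (harr ▸ hX) (G := G) ?_ hX1 hG1 hσ1 hσ hv hvn hB.index hZB).weaken le_rfl ?_
    · rw [harr, hother 4 (by omega)]
      exact hG
    rintro s₃ ⟨hA₃, hother₃, hX₃⟩
    refine ⟨(hA₂.mono (by omega)).trans (hA₃.mono (by omega)), ?_, ?_, _, hX₃, ?_, ?_⟩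
    · rw [hA₃ 10 (by omega), hA₂ 10 (by omega), h10]
    · intro k hk
      rw [hother₃ k hk, harr, hother k hk]
    · intro i hi
      have h1 : |G v i * σ| ≤ n := by
        rw [abs_mul]
        exact (mul_le_of_le_one_right (abs_nonneg _) hσ1).trans (hG1 v hvn i hi)
      refine (abs_add_le _ _).trans ((add_le_add (hX1 i hi) h1).trans (le_of_eq ?_))
      push_cast
      ring
    · have hstep : ∀ hσ : (σ = 1 ∧ X v < 0) ∨ (σ = -1 ∧ (2 * n ^ 2 * lam : ℕ) < X v),
          RelaxInv M x₀ lam (t + 1) fun k : Fin n => X k + G v k * σ := by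
        intro hσ
        have := hR.step hM (v := ⟨v, hvn⟩) (σ := σ) (by simpa using hσ)
        convert this using 3 with k
        rw [mul_comm σ, ← hGM ⟨v, hvn⟩ k]
      -- No violation means σ = 0: X is unchanged and the first alternative of the invariant holds
      -- from now on.
      rcases hvio with ⟨rfl, h0⟩ | h0
      · simp only [mul_zero, add_zero]
        exact hR.feasible fun k => by simpa using h0 k k.2
      · exact hstep h0
  · rintro s' hA ⟨h1, X, h2, h3, h4⟩
    exact ⟨hA, h1, X, h2, fun i hi => (h3 i hi).trans (by exact_mod_cast hB.point), h4⟩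

/-- The algorithm. -/
def solve : Prog :=
  setup ;; putIdentity ;; eliminateAll ;; gram ;; startPoint ;; relax ;; findViolated ;;
    checkResidual ;; .arith .mul 13 11 11 ;; .ifLt 3 13 (.const 0 0 ;; .skip) output

end RatRAM

/-! ### Correctness of the complete algorithm. -/

namespace BoundedSystem

open RatRAM

/-- The matrix of the system, filled up with zeros. -/
def entry (S : BoundedSystem) (i j : ℕ) : ℤ :=
  if h : i < S.m ∧ j < S.n then S.A ⟨i, h.1⟩ ⟨j, h.2⟩ else 0

/-- The right-hand side of the system, filled up with zeros. -/
def rhs (S : BoundedSystem) (i : ℕ) : ℤ := if h : i < S.m then S.b ⟨i, h⟩ else 0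

theorem isMat_input (S : BoundedSystem) : IsMat (S.input.arr 0) (S.m + S.n) S.n S.entry := by
  intro i _ j hj
  by_cases hi : i < S.m
  · have hlt : i * S.n + j < S.m * S.n := index_lt hi hj
    have he : finProdFinEquiv.symm ⟨i * S.n + j, hlt⟩ = ((⟨i, hi⟩ : Fin S.m), (⟨j, hj⟩ : Fin S.n)) := by
      rw [Equiv.symm_apply_eq]
      ext
      simp [finProdFinEquiv]
      ring
    simp only [input, if_true, dif_pos hlt, he, entry, dif_pos (And.intro hi hj)]
  · have hge : ¬ i * S.n + j < S.m * S.n := by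
      have : S.m * S.n ≤ i * S.n := Nat.mul_le_mul_right _ (not_lt.1 hi)
      omega
    simp [input, hge, entry, hi]

theorem isVec_input (S : BoundedSystem) : IsVec (S.input.arr 1) (S.m + S.n) S.rhs := by
  intro i _
  by_cases hi : i < S.m <;> simp [input, rhs, hi]

theorem encodes_input (S : BoundedSystem) :
    Encodes S.A S.b 1 0 (fun i j => if i = S.m + j then 1 else S.entry i j) S.rhs where
  top i j := by
    have : (i : ℕ) ≠ S.m + j := by omega
    simp [this, entry]
  bot k j := by
    rcases eq_or_ne k j with rfl | h
    · rw [Matrix.one_apply_eq, if_pos rfl]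
    · have : (k : ℕ) ≠ j := fun e => h (Fin.ext e)
      rw [Matrix.one_apply_ne h]
      simp [this, entry]
  ztop i := by simp [rhs]
  zbot k := by simp [rhs]

/-- A system with a strict solution has a deep point with respect to any parametrization of its
solution set. -/
theorem exists_isDeepPoint (S : BoundedSystem) (hA : S.A.IsTotallyUnimodular)
    {R : Set (Fin S.m)} {M : Matrix (Fin S.n) (Fin S.n) ℤ} {x₀ : Fin S.n → ℤ}
    (hE : ElimInv S.A S.b R M x₀) {x : Fin S.n → ℝ} (hx : S.IsStrictSolution x) :
    ∃ y, IsDeepPoint M x₀ S.lam y := by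
  obtain ⟨y, hy, hyb⟩ := exists_solution_with_slack hA S.b S.lam x hx.1 hx.2
  exact ⟨y, hE.sol y hy, hyb⟩

theorem correctAnswer_of_feasible (S : BoundedSystem) (hn : 0 < S.n)
    {M : Matrix (Fin S.n) (Fin S.n) ℤ} {x₀ : Fin S.n → ℤ} (hE : ElimInv S.A S.b Set.univ M x₀)
    (hres : ∀ i, S.b i - S.A.mulVec x₀ i = 0) {t : ℕ} {X : ℕ → ℤ}
    (hR : RelaxInv M x₀ S.lam t fun k => X k)
    (hX : ∀ i < S.n, 0 ≤ X i ∧ X i ≤ (2 * S.n ^ 2 * S.lam : ℕ)) {s : Mem} (h0 : s.reg 0 = 1)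
    (h2 : ∀ i < S.n, s.arr 2 i = (X i : ℚ) / (2 * S.n ^ 2 : ℕ)) : S.CorrectAnswer s := by
  have hD : (0 : ℝ) < 2 * (S.n : ℝ) ^ 2 := by positivity
  have hs : (fun j : Fin S.n => (s.arr 2 j : ℝ)) =
      fun j : Fin S.n => (X j : ℝ) / ((2 * S.n ^ 2 : ℤ) : ℝ) := by
    funext j
    rw [h2 j j.2]
    push_cast
    rfl
  refine Or.inl ⟨h0, ?_, fun j => ?_⟩
  · obtain ⟨Y, hY, _⟩ := hR
    rw [hs]
    exact hE.mulVec_eq hres (by positivity) (fun k => by simpa using hY k)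
  · have hj := congrFun hs j
    simp only at hj ⊢
    rw [hj]
    obtain ⟨h1, h2⟩ := hX j j.2
    have h1' : (0 : ℝ) ≤ X j := by exact_mod_cast h1
    have h2' : (X j : ℝ) ≤ 2 * (S.n : ℝ) ^ 2 * S.lam := by exact_mod_cast h2
    push_cast
    exact ⟨by positivity, by rw [div_le_iff₀ hD]; linarith⟩

/-- This is where the dichotomy between infeasible and strictly feasible is used: a solution would
give a strict one, and that a deep point, which the exhausted potential excludes. -/
theorem not_isSolution_of_violation (S : BoundedSystem) (hA : S.A.IsTotallyUnimodular)
    (hstrict : (∃ x, S.IsSolution x) → ∃ x, S.IsStrictSolution x)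
    {M : Matrix (Fin S.n) (Fin S.n) ℤ} {x₀ : Fin S.n → ℤ} (hE : ElimInv S.A S.b Set.univ M x₀)
    {X : ℕ → ℤ} (hR : RelaxInv M x₀ S.lam (4 * S.n ^ 4 * S.lam ^ 2) fun k => X k) {σ : ℤ} {v : ℕ}
    (hv : v < S.n) (hσ : σ ≠ 0) (hvio : IsViolation X S.n (2 * S.n ^ 2 * S.lam) σ v) :
    ¬ ∃ x, S.IsSolution x := by
  intro h
  obtain ⟨x, hx⟩ := hstrict h
  obtain ⟨y, hy⟩ := S.exists_isDeepPoint hA hE hx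
  refine RelaxInv.no_deep_point hE.abs_le (by simpa using hR) (v := ⟨v, hv⟩) (σ := σ) ?_ y hy
  rcases hvio with ⟨h0, _⟩ | h0
  · exact absurd h0 hσ
  · simpa using h0

/-- An upper bound for the number of steps of the algorithm. -/
def steps (m n lam : ℕ) : ℕ :=
  1 + (n * 5 + 2) + 1 + 1 + (m * 6 + 2) + (n * 7 + 2 + 2) +
    (4 * n ^ 4 * lam ^ 2 * (n * 8 + 2 + 1 + (n * 7 + 2 + 2) + 2) + 2) + (n * 7 + 2) +
    (n * (n * (2 + (n * 8 + 2) + 3 + 2) + 2 + 3 + 2) + 2) +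
    (m * ((m + n) * (n * 8 + 2 + 8 + 2) + 2 + 1 + (n * 9 + 2 + 3) + 2) + 2) + (n * 6 + 2) + 6

theorem wp_solve (S : BoundedSystem) (hn : 0 < S.n) (hA : S.A.IsTotallyUnimodular)
    (hstrict : (∃ x, S.IsSolution x) → ∃ x, S.IsStrictSolution x) {Z B : ℕ}
    (hZ : ∀ i, |S.b i| ≤ Z) (hB : Fits S.m S.n S.lam (2 ^ S.m * Z) B) :
    Wp solve (steps S.m S.n S.lam) B S.input S.CorrectAnswer := by
  have hB1 := hB.index
  -- The summands stand in reverse order of execution, as `Wp.seq` puts the cost of the second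
  -- program first.
  unfold steps
  refine .seq (wp_setup (m := S.m) (n := S.n) (lam := S.lam) rfl rfl rfl rfl (by omega) (by omega)
    hB.scale hB.bound hB.rounds) ?_
  rintro s₁ ⟨E₁, harr₁⟩
  refine .seq (wp_putIdentity E₁ (harr₁ ▸ S.isMat_input) hB.index) ?_
  rintro s₂ ⟨hA₂, hother₂, hT₂⟩
  have E₂ := E₁.of_agree hA₂ le_rfl
  refine .seq (wp_eliminateAll E₂ hn (A := S.A) (b := S.b) (Z := Z)
    ⟨1, 0, _, S.rhs, hT₂, ?_, ElimInv.init hA S.b, S.encodes_input, ?_⟩ hB) ?_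
  · rw [hother₂ 1 (by omega), harr₁]
    exact S.isVec_input
  · intro i _
    by_cases hi : i < S.m
    · simpa [rhs, hi] using hZ ⟨i, hi⟩
    · simp [rhs, hi]
  rintro s₃ ⟨hA₃, -, M, x₀, T, z, hT, hz, hE, hC, hzZ⟩
  have E₃ := E₂.of_agree hA₃ le_rfl
  have hT1 := hC.abs_le hE
  refine .seq (wp_gram E₃ hT hT1 hB.index) ?_
  rintro s₄ ⟨hA₄, hother₄, hG⟩
  have E₄ := E₃.of_agree hA₄ le_rfl
  have hz₄ : IsVec (s₄.arr 1) (S.m + S.n) z := by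
    rw [hother₄ 1 (by omega)]
    exact hz
  refine .seq (wp_startPoint E₄ hz₄ hzZ hB.index (by have := hB.vec; omega)
    (by have := hB.point; omega)) ?_
  rintro s₅ ⟨hA₅, hother₅, hX⟩
  have E₅ := E₄.of_agree hA₅ le_rfl
  refine .seq (wp_relax E₅ hn hE.abs_le (x₀ := x₀) (G := fun i j =>
    ∑ k ∈ Finset.range S.n, T (S.m + i) k * T (S.m + j) k) ?_ ?_ ?_ hX ?_ ?_ hB) ?_
  · rw [hother₅ 4 (by omega)]
    exact hG
  · intro i hi j hj
    exact abs_sum_mul_le (hT1 (S.m + i) (by omega)) (hT1 (S.m + j) (by omega)) le_rfl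
  · intro i j
    rw [Finset.sum_range]
    exact Finset.sum_congr rfl fun k _ => by rw [hC.bot, hC.bot]
  · intro i hi
    rw [abs_mul, abs_neg, abs_of_nonneg (by positivity : (0 : ℤ) ≤ 2 * (S.n : ℤ) ^ 2)]
    have := mul_le_mul_of_nonneg_right (hzZ (S.m + i) (by omega))
      (by positivity : (0 : ℤ) ≤ 2 * (S.n : ℤ) ^ 2)
    exact_mod_cast this
  · have := RelaxInv.init M x₀ S.lam
    convert this using 2 with k
    rw [hC.zbot]
    simp
    ring
  rintro s₆ ⟨hA₆, hother₆, X, hX, hXB, hR⟩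
  have E₆ := E₅.of_agree hA₆ le_rfl
  refine .seq (wp_findViolated E₆ hn hX hXB (by omega)) ?_
  rintro s₇ ⟨hA₇, harr₇, σ, v, hσ, -, hv, hvio⟩
  have E₇ := E₆.of_agree hA₇ (by omega)
  have hz₇ : IsVec (s₇.arr 1) (S.m + S.n) z := by
    rw [harr₇, hother₆ 1 (by omega), hother₅ 1 (by omega)]
    exact hz₄
  refine .seq (wp_checkResidual E₇ hz₇ hzZ hσ (by omega) (by have := hB.vec; omega) hB.vec_sq) ?_
  rintro s₈ ⟨hA₈, harr₈, hres⟩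
  have E₈ := E₇.of_agree hA₈ (by omega)
  -- ρ is the joint failure flag. The relaxation has been run even for inconsistent equations, which
  -- is harmless because its invariant does not involve the residual.
  obtain ⟨ρ, hρ, hρ1, hρ0⟩ : ∃ ρ : ℤ, s₈.reg 11 = ρ ∧ |ρ| ≤ 1 ∧
      ((ρ = 0 ∧ σ = 0 ∧ ∀ i < S.m, z i = 0) ∨ (ρ ≠ 0 ∧ (σ ≠ 0 ∨ ∃ i < S.m, z i ≠ 0))) := by
    rcases hres with ⟨h, h'⟩ | ⟨h, h'⟩
    · refine ⟨σ, h, ?_, ?_⟩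
      · rcases hvio with ⟨rfl, _⟩ | ⟨rfl, _⟩ | ⟨rfl, _⟩ <;> simp
      · by_cases h0 : σ = 0
        · exact Or.inl ⟨h0, h0, h'⟩
        · exact Or.inr ⟨h0, Or.inl h0⟩
    · exact ⟨1, by simpa using h, by simp, Or.inr ⟨by simp, Or.inr h'⟩⟩
  refine .mul (t := 1 + (S.n * (3 + 2) + 2) + 1) (ρ * ρ) (by simp [hρ]) ?_ (.ite ?_ ?_)
  · rw [abs_mul]
    exact (mul_le_one₀ hρ1 (abs_nonneg _) hρ1).trans (by omega)
  · intro hlt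
    have hne : ρ ≠ 0 := by
      intro h
      simp [Mem.setReg, E₈.r3, h] at hlt
    refine .const 0 (by simp) (.skip (Or.inr ⟨by simp [Mem.setReg], ?_⟩))
    rcases hρ0 with ⟨h, _⟩ | ⟨_, h | ⟨i, hi, h⟩⟩
    · exact absurd h hne
    · exact S.not_isSolution_of_violation hA hstrict hE hR hv h hvio
    · rintro ⟨x, hx⟩
      refine h ?_
      rw [hC.ztop ⟨i, hi⟩]
      exact hE.residual_eq_zero hx.1 _
  · intro hlt
    have h0 : ρ = 0 := by simpa [Mem.setReg, E₈.r3] using hlt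
    rcases hρ0 with ⟨_, rfl, hz0⟩ | ⟨h, _⟩
    · refine (wp_output (m := S.m) (lam := S.lam) (B := B) (X := X)
        (E₈.of_agree (L := 10) ((Agree.refl _ _).setReg (by omega)) le_rfl) hn
        (by simpa [Mem.setReg, harr₈, harr₇] using hX) hXB (by omega) hB.scale).weaken le_rfl ?_
      rintro s' ⟨h1, h2⟩
      refine S.correctAnswer_of_feasible hn hE (fun i => ?_) hR ?_ h1 h2
      · rw [← hC.ztop]
        exact hz0 i i.2
      · rcases hvio with ⟨_, h⟩ | ⟨h, _⟩ | ⟨h, _⟩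
        · exact h
        · simp at h
        · simp at h
    · exact absurd h0 h

end BoundedSystem

/-! ### Polynomial bounds on number sizes and step counts. -/

namespace BoundedSystem

open RatRAM

theorem natCast_le_two_pow_of_bitSize_le {k s : ℕ} (h : bitSize (k : ℚ) ≤ s) : k ≤ 2 ^ s := by
  have h1 := (Nat.lt_size_self k).le
  have h2 : k.size ≤ s := by
    simp only [bitSize, Rat.num_natCast, Int.natAbs_natCast] at h
    omega
  exact h1.trans (Nat.pow_le_pow_right (by omega) h2)

theorem abs_rhs_le (S : BoundedSystem) (i : Fin S.m) : |S.b i| ≤ (2 ^ S.size : ℕ) := by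
  have h1 : bitSize (S.b i) ≤ S.size :=
    (Finset.single_le_sum (f := fun i => bitSize (S.b i)) (fun _ _ => Nat.zero_le _)
      (Finset.mem_univ i)).trans (Nat.le_add_left _ _)
  have h2 : (S.b i).natAbs.size ≤ S.size := by
    simp only [bitSize, Rat.num_intCast] at h1
    omega
  have h3 : (S.b i).natAbs ≤ 2 ^ S.size :=
    (Nat.lt_size_self _).le.trans (Nat.pow_le_pow_right (by omega) h2)
  rw [Int.abs_eq_natAbs]
  exact_mod_cast h3

/-- Each right-hand side entry contributes at least one bit; hence the growth factor `2 ^ m` from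
elimination is at most `2 ^ size`. -/
theorem m_le_size (S : BoundedSystem) : S.m ≤ S.size := by
  have h : ∑ _i : Fin S.m, 1 ≤ ∑ i, bitSize (S.b i) :=
    Finset.sum_le_sum fun i _ => by simp only [bitSize]; omega
  simp only [Finset.sum_const, Finset.card_univ, Fintype.card_fin, smul_eq_mul, mul_one] at h
  exact h.trans (Nat.le_add_left _ _)

/-- With N = 2 ^ size ≥ 8, each small constant is absorbed by one more factor N. The exponent 12 is
generous: no estimate needs more than N⁸. -/
theorem fits_size (S : BoundedSystem) :
    Fits S.m S.n S.lam (2 ^ S.m * 2 ^ S.size) (2 ^ (12 * S.size)) := by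
  have hm : S.m ≤ 2 ^ S.size := natCast_le_two_pow_of_bitSize_le (by simp only [size]; omega)
  have hn : S.n ≤ 2 ^ S.size := natCast_le_two_pow_of_bitSize_le (by simp only [size]; omega)
  have hl : S.lam ≤ 2 ^ S.size := natCast_le_two_pow_of_bitSize_le (by simp only [size]; omega)
  have hZ : 2 ^ S.m ≤ 2 ^ S.size := Nat.pow_le_pow_right (by omega) S.m_le_size
  have hs : 3 ≤ S.size := by
    have h1 : ∀ q, 1 ≤ bitSize q := fun q => by simp only [bitSize]; omega
    have := h1 S.m
    have := h1 S.n
    have := h1 S.lam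
    simp only [size]
    omega
  have h8 : 8 ≤ 2 ^ S.size := (Nat.pow_le_pow_right (by omega) hs : 2 ^ 3 ≤ 2 ^ S.size)
  rw [mul_comm 12, pow_mul]
  generalize 2 ^ S.size = N at *
  generalize 2 ^ S.m = z at *
  generalize S.m = m at *
  generalize S.n = n at *
  generalize S.lam = l at *
  have hpow : ∀ a b, a ≤ b → N ^ a ≤ N ^ b := fun a b h => Nat.pow_le_pow_right (by omega) h
  have hstep : ∀ a, 8 * N ^ a ≤ N ^ (a + 1) := fun a => by
    rw [pow_succ, mul_comm]
    exact Nat.mul_le_mul_left _ h8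
  have h2 : n ^ 2 ≤ N ^ 2 := Nat.pow_le_pow_left hn 2
  have hzN : z * N ≤ N ^ 2 := by
    rw [sq]
    exact Nat.mul_le_mul_right _ hZ
  have h4 : n ^ 4 * l ^ 2 ≤ N ^ 6 := by
    calc n ^ 4 * l ^ 2 ≤ N ^ 4 * N ^ 2 :=
          Nat.mul_le_mul (Nat.pow_le_pow_left hn 4) (Nat.pow_le_pow_left hl 2)
      _ = N ^ 6 := by ring
  have s2 : 8 * N ^ 2 ≤ N ^ 3 := hstep 2
  have s3 : 8 * N ^ 3 ≤ N ^ 4 := hstep 3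
  have s4 : 8 * N ^ 4 ≤ N ^ 5 := hstep 4
  have s6 : 8 * N ^ 6 ≤ N ^ 7 := hstep 6
  have s7 : 8 * N ^ 7 ≤ N ^ 8 := hstep 7
  have s1 : 8 * N ≤ N ^ 2 := by simpa using hstep 1
  have p3 := hpow 3 12 (by omega)
  have p4 := hpow 4 12 (by omega)
  have p5 := hpow 5 12 (by omega)
  have p7 := hpow 7 12 (by omega)
  have p8 := hpow 8 12 (by omega)
  constructor
  · have : (m + n) * n ≤ (N + N) * N := Nat.mul_le_mul (by omega) hn
    have : (N + N) * N = 2 * N ^ 2 := by ring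
    omega
  · omega
  · have : 2 * n ^ 2 * l ≤ 2 * N ^ 2 * N := Nat.mul_le_mul (by omega) hl
    have : 2 * N ^ 2 * N = 2 * N ^ 3 := by ring
    omega
  · rw [mul_assoc]
    omega
  · omega
  · have : (z * N) * (z * N) ≤ N ^ 2 * N ^ 2 := Nat.mul_le_mul hzN hzN
    have : N ^ 2 * N ^ 2 = N ^ 4 := by ring
    omega
  · have h1 : z * N * (2 * n ^ 2) ≤ N ^ 2 * (2 * N ^ 2) := Nat.mul_le_mul hzN (by omega)
    have h2 : N ^ 2 * (2 * N ^ 2) = 2 * N ^ 4 := by ring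
    have h3 : 4 * n ^ 4 * l ^ 2 * n ≤ 4 * N ^ 6 * N := Nat.mul_le_mul (by rw [mul_assoc]; omega) hn
    have h5 : 4 * N ^ 6 * N = 4 * N ^ 7 := by ring
    omega

/-- The term n⁵λ² comes from 4n⁴λ² relaxation rounds of O(n) steps, the mixed terms from
elimination. Positivity of n and λ lets these absorb everything of lower order. -/
theorem steps_le {m n lam : ℕ} (hn : 0 < n) (hl : 0 < lam) :
    steps m n lam ≤ 200 * (m ^ 2 * n + n ^ 2 * m + n ^ 5 * lam ^ 2) := by
  have hl2 : 1 ≤ lam ^ 2 := Nat.one_le_pow _ _ hl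
  have hp : ∀ a ≤ 5, n ^ a ≤ n ^ 5 * lam ^ 2 := fun a ha =>
    (Nat.pow_le_pow_right hn ha).trans (Nat.le_mul_of_pos_right _ hl2)
  have h0 := hp 0 (by omega)
  have h1 := hp 1 (by omega)
  have h2 := hp 2 (by omega)
  have h3 := hp 3 (by omega)
  have h4 : n ^ 4 * lam ^ 2 ≤ n ^ 5 * lam ^ 2 :=
    Nat.mul_le_mul_right _ (Nat.pow_le_pow_right hn (by omega))
  have h5 : m ≤ n ^ 2 * m := Nat.le_mul_of_pos_left _ (by positivity)
  have h6 : n * m ≤ n ^ 2 * m := Nat.mul_le_mul_right _ (Nat.le_self_pow (by omega) n)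
  have h7 : m ^ 2 ≤ m ^ 2 * n := Nat.le_mul_of_pos_right _ hn
  unfold steps
  ring_nf at *
  omega

/-- Because (7/5)² = 49/25 < 2. -/
theorem two_le_inv_logb : 2 ≤ 1 / Real.logb 2 (7 / 5) := by
  have h0 : 0 < Real.logb 2 (7 / 5) := Real.logb_pos (by norm_num) (by norm_num)
  rw [le_div_iff₀ h0]
  have h1 : Real.logb 2 ((7 / 5) ^ (2 : ℕ)) ≤ 1 := by
    rw [Real.logb_le_iff_le_rpow (by norm_num) (by norm_num)]
    norm_num
  rw [Real.logb_pow] at h1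
  exact_mod_cast h1

/-- The base is at least 1, so the exponent may be lowered to 2; the square of the base is
4n²λ²(2n+1) ≥ n³λ². -/
theorem pow_five_mul_sq_le {n lam : ℕ} (hn : 0 < n) (hl : 0 < lam) :
    (n : ℝ) ^ 5 * (lam : ℝ) ^ 2 ≤
      (n : ℝ) ^ 2 * (2 * n * lam * Real.sqrt (2 * n + 1)) ^ (1 / Real.logb 2 (7 / 5)) := by
  have hn1 : (1 : ℝ) ≤ n := by exact_mod_cast hn
  have hl1 : (1 : ℝ) ≤ lam := by exact_mod_cast hl
  have hs : 1 ≤ Real.sqrt (2 * n + 1) := Real.one_le_sqrt.2 (by linarith)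
  have hnl : 1 ≤ (n : ℝ) * lam := one_le_mul_of_one_le_of_one_le hn1 hl1
  have hbase : 1 ≤ 2 * n * lam * Real.sqrt (2 * n + 1) := by
    have : (1 : ℝ) ≤ 2 * n * lam := by nlinarith
    exact one_le_mul_of_one_le_of_one_le this hs
  calc (n : ℝ) ^ 5 * (lam : ℝ) ^ 2 = (n : ℝ) ^ 2 * ((n : ℝ) ^ 2 * (lam : ℝ) ^ 2 * n) := by ring
    _ ≤ (n : ℝ) ^ 2 * (4 * ((n : ℝ) ^ 2 * (lam : ℝ) ^ 2) * (2 * n + 1)) := by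
        refine mul_le_mul_of_nonneg_left ?_ (by positivity)
        refine mul_le_mul ?_ (by linarith) (by positivity) (by positivity)
        have : (0 : ℝ) ≤ (n : ℝ) ^ 2 * (lam : ℝ) ^ 2 := by positivity
        linarith
    _ = (n : ℝ) ^ 2 * (2 * n * lam * Real.sqrt (2 * n + 1)) ^ 2 := by
        rw [mul_pow _ (Real.sqrt _), Real.sq_sqrt (by positivity)]
        ring
    _ ≤ _ := by
        refine mul_le_mul_of_nonneg_left ?_ (by positivity)
        rw [← Real.rpow_natCast]
        exact Real.rpow_le_rpow_of_exponent_le hbase (by exact_mod_cast two_le_inv_logb)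

end BoundedSystem

theorem theorem3 :
    ∃ P : RatRAM.Prog, ∀ p : MvPolynomial (Fin 2) ℕ,
      ∃ (ops : MvPolynomial (Fin 2) ℕ) (bits : Polynomial ℕ) (C : ℝ),
        ∀ S : BoundedSystem, 0 < S.n → 0 < S.lam → S.A.IsTotallyUnimodular →
          S.lam ≤ MvPolynomial.eval ![S.n, S.m] p →
          ((∃ x, S.IsSolution x) → ∃ x, S.IsStrictSolution x) →
          ∃ (t w : ℕ) (s : RatRAM.Mem),
            RatRAM.Exec P S.input t w s ∧ S.CorrectAnswer s ∧
            t ≤ MvPolynomial.eval ![S.n, S.m] ops ∧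
            w ≤ bits.eval S.size ∧
            (t : ℝ) ≤ C * ((S.m : ℝ) ^ 3 + (S.m : ℝ) ^ 2 * S.n + (S.n : ℝ) ^ 2 * S.m +
              (S.n : ℝ) ^ 2 *
                (2 * S.n * S.lam * Real.sqrt (2 * S.n + 1)) ^ (1 / Real.logb 2 (7 / 5))) ∧
            (S.lam = 1 →
              (t : ℝ) ≤ C * ((S.m : ℝ) ^ 3 + (S.m : ℝ) ^ 2 * S.n + (S.n : ℝ) ^ 2 * S.m +
                (S.n : ℝ) ^ (5.1 : ℝ))) := by
  -- `ops` is the step bound with λ replaced by p. In `bits`, 24 and 7 come from 2 (12 size + 1) +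
  -- 5, as `2 ^ (12 * size)` has 12 size + 1 binary digits. The constant 200 does not depend on p.
  refine ⟨RatRAM.solve, fun p => ⟨200 * (MvPolynomial.X 1 ^ 2 * MvPolynomial.X 0 +
    MvPolynomial.X 0 ^ 2 * MvPolynomial.X 1 + MvPolynomial.X 0 ^ 5 * p ^ 2),
    24 * Polynomial.X + 7, 200, ?_⟩⟩
  intro S hn hl hA hp hstrict
  obtain ⟨t, w, s, hexec, ht, hw, hs⟩ :=
    S.wp_solve hn hA hstrict S.abs_rhs_le S.fits_size
  have ht' := ht.trans (BoundedSystem.steps_le hn hl)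
  have htR : (t : ℝ) ≤ 200 * ((S.m : ℝ) ^ 2 * S.n + (S.n : ℝ) ^ 2 * S.m +
      (S.n : ℝ) ^ 5 * (S.lam : ℝ) ^ 2) := by exact_mod_cast ht'
  have hm3 : (0 : ℝ) ≤ (S.m : ℝ) ^ 3 := by positivity
  refine ⟨t, w, s, hexec, hs, ht'.trans ?_, hw.trans ?_, ?_, ?_⟩
  · have : S.lam ^ 2 ≤ MvPolynomial.eval ![S.n, S.m] p ^ 2 := Nat.pow_le_pow_left hp 2
    simp only [map_mul, map_add, map_pow, MvPolynomial.eval_X, map_ofNat, Matrix.cons_val_zero,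
      Matrix.cons_val_one]
    gcongr
  · simp [Nat.size_pow]
    omega
  · have := BoundedSystem.pow_five_mul_sq_le hn hl
    linarith
  · intro h1
    have hn1 : (1 : ℝ) ≤ S.n := by exact_mod_cast hn
    have : (S.n : ℝ) ^ 5 ≤ (S.n : ℝ) ^ (5.1 : ℝ) := by
      rw [← Real.rpow_natCast]
      exact Real.rpow_le_rpow_of_exponent_le hn1 (by norm_num)
    rw [h1] at htR
    simp only [Nat.cast_one, one_pow, mul_one] at htR
    linarith
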